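/- **Setting.** A treeplex consists of a finite set of indices partitioned into nonempty information sets $h$, with index sets $\Omega_h$, and for every $h$ a parent index $\sigma(h)$, or no parent (then $z_{\sigma(h)}:=1$), without cycles. For $\gamma\ge 0$ its $\gamma$-perturbed strategies are the vectors $z$ with $\sum_{i\in\Omega_h}z_i=z_{\sigma(h)}$ and $z_i\ge\gamma z_{\sigma(h)}$ for all $h$ and $i\in\Omega_h$; a strategy is generated by its conditional form $q$ through $z_i=z_{\sigma(h)}q_i$, where $q_h:=(q_i)_{i\in\Omega_h}$ lies in $\Delta_h^\gamma=\{p\in\mathbb R^{\Omega_h}:p_i\ge\gamma,\ \sum_i p_i=1\}$. Let $\mathcal X,\mathcal Y$ be treeplexes (with perturbed strategy sets $\mathcal X^\gamma,\mathcal Y^\gamma$), $A$ a payoff matrix with entries in $[-1,1]$, $z=(x,y)$, $F(z)=(Ay,-A^\top x)$. Let $\alpha_h>0$ be weights of the information sets of both players, $\psi^\Delta(p)=\sum_i p_i^2$, and let $\psi(z)=\sum_h\alpha_h z_{\sigma(h)}\psi^\Delta(z_h/z_{\sigma(h)})$ be the dilated Euclidean regularizer. For $\tau>0$ let $z^{\gamma,*}_\tau$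 denote the Nash equilibrium of $\min_{x\in\mathcal X^\gamma}\max_{y\in\mathcal Y^\gamma}x^\top Ay+\tau\psi(x)-\tau\psi(y)$, and $z^*_\tau=z^{0,*}_\tau$. $D$ denotes Bregman divergence; in $D_\psi(z',z)$ the gradient of $\psi$ at $z$ is expressed through the conditional form $q$ of $z$, which extends it continuously to points where some $z_{\sigma(h)}=0$, so that $D_\psi(z',z)=\sum_h\alpha_h z'_{\sigma(h)}\|q'_h-q_h\|_2^2$. **Algorithm (Reg-CFR).** Put $W^h(z)=\sum_{i\in\Omega_h}q_iV_i(z)+\tau\alpha_h\psi^\Delta(q_h)$, $V_i(z)=F(z)_i+\sum_{h':\sigma(h')=i}W^{h'}(z)$, $V^h(z)=(V_i(z))_{i\in\Omega_h}$. Let $q_{0,h}=q_{1/2,h}$ be uniform and, for $t\ge1$ and every $h$, $$q_{t,h}=\arg\min_{p\in\Delta_h^\gamma}\langle V^h(z_{t-\frac12})+\tau\alpha_h\nabla\psi^\Delta(q_{t-1,h}),p\rangle+\lambda^h_{t-1}D_{\psi^\Delta}(p,q_{t-1,h})+(\lambda^h_t-\lambda^h_{t-1})D_{\psi^\Delta}(p,q_{1,h}),$$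 $$q_{t+\frac12,h}=\arg\min_{p\in\Delta_h^\gamma}\langle V^h(z_{t-\frac12})+\tau\alpha_h\nabla\psi^\Delta(q_{t,h}),p\rangle+\lambda^h_{t}D_{\psi^\Delta}(p,q_{t,h}),$$ where $z_t$, $z_{t+\frac12}$ have conditional forms $q_t$, $q_{t+\frac12}$, $\lambda^h_t=\big(\kappa+\sum_{s=1}^{t-1}\|V^h(z_{s+\frac12})-V^h(z_{s-\frac12})\|_2^2\big)^{1/2}$, and $\kappa\ge1$ is a hyper-parameter. **Theorem.** For fixed treeplexes and weights $\alpha$: 1. Let $\gamma>0$ and $\kappa\ge1$. There is a constant $C_\gamma>0$ such that for all $A$ and all $0<\tau\le\frac1{2\|\alpha\|_\infty}$, the iterates satisfy $\sum_{t=1}^TD_\psi(z^{\gamma,*}_\tau,z_t)\le C_\gamma/\tau$ for all $T$; in particular $D_\psi(z^{\gamma,*}_\tau,z_t)\to0$ as $t\to\infty$ (asymptotic last-iterate convergence). 2. Let $\gamma=0$. (a) For every $\tau>0$ and every fixed $\kappa\ge1$ with $2\tau\|\alpha\|_\infty\le\sqrt\kappa$ (in particular for every $\kappa\ge1$ if $\tau\le\frac1{2\|\alpha\|_\infty}$)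 there is a constant $C>0$, possibly depending on $\kappa$ and $\tau$, such that for all $A$ and all $T\ge1$: $\sum_{t=1}^TD_\psi(z^*_\tau,z_t)\le C\,T^{1/4}/\tau$ and $\min_{1\le t\le T}D_\psi(z^*_\tau,z_t)\le\frac C\tau T^{-3/4}$. (b) If the hyper-parameter is tuned to the horizon, $\kappa=\sqrt T$, then both bounds hold for all $A$, all $\tau\in(0,1]$ and all $T\ge1$ with a constant $C>0$ that depends on neither $\tau$ nor $T$. -/

import Mathlib

open Filter Topology

/-- A treeplex in sequence form, with index set `I` and set of information sets `H`:
`infoset i` is the information set `h(i)` containing the index `i`, and `parent h` is the index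
`σ(h)` of the parent variable of `h` (`none` when `h` is a root, that is `σ(h) = 0`).
Every information set has at least one index, and going to the parent never cycles. -/
structure Treeplex (I H : Type*) where
  infoset : I → H
  parent : H → Option I
  infoset_surjective : Function.Surjective infoset
  acyclic : WellFounded fun h h' : H => ∃ i, parent h' = some i ∧ infoset i = h

namespace Treeplex

theorem acyclic_swap {I H : Type*} [Finite H] (T : Treeplex I H) :
    WellFounded fun h' h : H => ∃ i, T.parent h' = some i ∧ T.infoset i = h := by
  let R : H → H → Prop := fun h h' => ∃ i, T.parent h' = some i ∧ T.infoset i = h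
  have key : WellFounded (Relation.TransGen R) := T.acyclic.transGen
  have : IsTrans H (fun a b => Relation.TransGen R b a) := ⟨fun a b c hab hbc => hbc.trans hab⟩
  have : Std.Irrefl (fun a b => Relation.TransGen R b a) := ⟨fun a ha => key.irrefl.irrefl a ha⟩
  exact Subrelation.wf (fun {a b} hab => Relation.TransGen.single hab)
    (Finite.wellFounded_of_trans_of_irrefl (fun a b => Relation.TransGen R b a))

section Single

variable {I H : Type*} [Fintype I] [Fintype H] [DecidableEq I] [DecidableEq H] (T : Treeplex I H)

/-- `Ω_h`, the indices belonging to the information set `h`. -/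
def Ω (h : H) : Finset I := Finset.univ.filter fun i => T.infoset i = h

/-- `H_i`, the information sets whose parent variable is `i`. -/
def children (i : I) : Finset H := Finset.univ.filter fun h => T.parent h = some i

/-- `z_{σ(h)}`, with the value `1` at a root. -/
def reach (z : I → ℝ) (h : H) : ℝ := (T.parent h).elim 1 z

/-- The treeplex as a set of sequence-form strategies, with the perturbation
`z_i / z_{σ(h(i))} ≥ γ`; the unperturbed treeplex is the case `γ = 0`. -/
def strategies (γ : ℝ) : Set (I → ℝ) :=
  {z | (∀ i, γ * T.reach z (T.infoset i) ≤ z i) ∧ ∀ h, ∑ i ∈ T.Ω h, z i = T.reach z h}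

/-- The `γ`-perturbed simplex at `h`; only the coordinates in `Ω_h` matter. -/
def simplex (γ : ℝ) (h : H) : Set (I → ℝ) :=
  {p | (∀ i ∈ T.Ω h, γ ≤ p i) ∧ ∑ i ∈ T.Ω h, p i = 1}

/-! ### Conditional form and sequence form -/

/-- The probability of reaching `h` under the conditional strategy `q`, counting only the moves in
this treeplex: the product of `q` along the path to `h`. -/
noncomputable def reachProb (q : I → ℝ) : H → ℝ :=
  T.acyclic.fix fun h ih =>
    match hp : T.parent h with
    | none => 1
    | some i => ih (T.infoset i) ⟨i, hp, rfl⟩ * q i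

/-- The sequence-form strategy `z` with conditional form `q`: `z_i = z_{σ(h(i))} q_i`. -/
noncomputable def toSeq (q : I → ℝ) (i : I) : ℝ := T.reachProb q (T.infoset i) * q i

theorem reach_toSeq {I H : Type*} (T : Treeplex I H) (q : I → ℝ) (h : H) : T.reach (T.toSeq q) h = T.reachProb q h := by
  unfold reachProb
  rw [WellFounded.fix_eq]
  unfold reach toSeq reachProb
  split <;> rename_i hp <;> simp [hp]

theorem toSeq_eq {I H : Type*} (T : Treeplex I H) (q : I → ℝ) (i : I) :
    T.toSeq q i = T.reach (T.toSeq q) (T.infoset i) * q i := by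
  rw [reach_toSeq]; rfl

/-! ### The Euclidean base regularizer and the dilated regularizer -/

/-- The base regularizer `ψ^Δ(p) = ∑_i p_i ^ 2` on the simplex at `h`. -/
def base (h : H) (p : I → ℝ) : ℝ := ∑ i ∈ T.Ω h, p i ^ 2

/-- The gradient of the base regularizer. -/
def baseGrad (p : I → ℝ) (i : I) : ℝ := 2 * p i

/-- The Bregman divergence of the base regularizer at `h`. -/
def baseBregman (h : H) (p q : I → ℝ) : ℝ :=
  T.base h p - T.base h q - ∑ i ∈ T.Ω h, baseGrad q i * (p i - q i)

/-- The dilated regularizer `ψ(z) = ∑_h α_h z_{σ(h)} ψ^Δ(z_h / z_{σ(h)})`; a term with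
`z_{σ(h)} = 0` is zero. -/
noncomputable def dilated (α : H → ℝ) (z : I → ℝ) : ℝ :=
  ∑ h, α h * T.reach z h * T.base h fun i => z i / T.reach z h

/-- The gradient of the dilated regularizer, written in terms of the conditional form `q` of the
point. It is the gradient wherever all `z_{σ(h)}` are nonzero, see `hasFDerivAt_dilated`, and its
continuous extension in `q` where some of them vanish and the dilated regularizer is not
differentiable. -/
noncomputable def dilatedGrad (α : H → ℝ) (q : I → ℝ) (i : I) : ℝ :=
  α (T.infoset i) * baseGrad q i +
    ∑ h ∈ T.children i, α h * (T.base h q - ∑ j ∈ T.Ω h, baseGrad q j * q j)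

/-- The Bregman divergence `D_ψ(z', z)` of the dilated regularizer, where `z` is the strategy with
conditional form `q`. -/
noncomputable def dilatedBregman (α : H → ℝ) (z' q : I → ℝ) : ℝ :=
  T.dilated α z' - T.dilated α (T.toSeq q) -
    ∑ i, T.dilatedGrad α q i * (z' i - T.toSeq q i)

/-! ### Counterfactual values -/

/-- `W^h`, the value of the subtree rooted at `h` when the loss of the index `i` is `g i`, the
weights of the regularizers are `c` and the treeplex is played according to the conditional form
`q`; its recursive equation is `W_eq`. -/
noncomputable def W (g : I → ℝ) (c : H → ℝ) (q : I → ℝ) : H → ℝ :=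
  T.acyclic_swap.fix fun h ih =>
    ∑ i : {i // T.infoset i = h},
      q i * (g i + ∑ h' : {h' // T.parent h' = some i.1}, ih h'.1 ⟨i.1, h'.2, i.2⟩) +
    c h * T.base h q

/-- The coordinates `V_i = g_i + ∑_{h' ∈ H_i} W^{h'}`; the vector `V^h` consists of those with
`i ∈ Ω_h`. -/
noncomputable def V (g : I → ℝ) (c : H → ℝ) (q : I → ℝ) (i : I) : ℝ :=
  g i + ∑ h' ∈ T.children i, T.W g c q h'

theorem W_eq (g : I → ℝ) (c : H → ℝ) (q : I → ℝ) (h : H) :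
    T.W g c q h = ∑ i ∈ T.Ω h, q i * T.V g c q i + c h * T.base h q := by
  have h1 : T.W g c q h = ∑ i : {i // T.infoset i = h},
      q i * (g i + ∑ h' : {h' // T.parent h' = some i.1}, T.W g c q h'.1) +
      c h * T.base h q := by
    unfold W
    rw [WellFounded.fix_eq]
  rw [h1]
  congr 1
  rw [← Finset.sum_subtype (T.Ω h) (by simp [Ω])
    (fun i => q i * (g i + ∑ h' : {h' // T.parent h' = some i}, T.W g c q h'.1))]
  refine Finset.sum_congr rfl fun i _ => ?_
  unfold V
  rw [Finset.sum_subtype (T.children i) (p := fun h' => T.parent h' = some i)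
    (by simp [children]) (fun h' => T.W g c q h')]

/-- The dilated regularizer has the expected gradient wherever all `z_{σ(h)}` are nonzero. -/
theorem hasFDerivAt_dilated (α : H → ℝ) (z : I → ℝ) (hz : ∀ h, T.reach z h ≠ 0) :
    HasFDerivAt (T.dilated α)
      (∑ i, T.dilatedGrad α (fun i => z i / T.reach z (T.infoset i)) i •
        (ContinuousLinearMap.proj i : (I → ℝ) →L[ℝ] ℝ)) z := by
  let P : I → (I → ℝ) →L[ℝ] ℝ := fun i => ContinuousLinearMap.proj i
  let L : H → (I → ℝ) →L[ℝ] ℝ := fun h => (T.parent h).elim 0 P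
  have hL : ∀ h, HasFDerivAt (fun w => T.reach w h) (L h) z := by
    intro h
    unfold reach
    rcases hp : T.parent h with _ | j
    · simpa [L, hp] using hasFDerivAt_const (1 : ℝ) z
    · simpa [L, hp, P] using hasFDerivAt_apply j z
  have hP : ∀ i, HasFDerivAt (fun w : I → ℝ => w i) (P i) z := fun i => hasFDerivAt_apply i z
  have hd : HasFDerivAt (T.dilated α) (∑ h, ∑ i ∈ T.Ω h, α h •
      ((2 * (z i / T.reach z h)) • P i - ((z i / T.reach z h) ^ 2) • L h)) z := by
    have heq : T.dilated α =ᶠ[𝓝 z] fun w => ∑ h, ∑ i ∈ T.Ω h,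
        α h * (w i ^ 2 * (T.reach w h)⁻¹) := by
      have hne : ∀ᶠ w in 𝓝 z, ∀ h, T.reach w h ≠ 0 :=
        Filter.eventually_all.2 fun h => (hL h).continuousAt.eventually_ne (hz h)
      filter_upwards [hne] with w hw
      unfold dilated base
      refine Finset.sum_congr rfl fun h _ => ?_
      rw [Finset.mul_sum]
      refine Finset.sum_congr rfl fun i _ => ?_
      have := hw h
      field_simp
    refine HasFDerivAt.congr_of_eventuallyEq ?_ heq
    refine HasFDerivAt.fun_sum fun h _ => HasFDerivAt.fun_sum fun i _ => ?_
    have h2 := (hasDerivAt_inv (hz h)).comp_hasFDerivAt z (hL h)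
    have h3 := (((hP i).pow 2).mul h2).const_mul (α h)
    refine h3.congr_fderiv ?_
    ext v
    have := hz h
    have hr : (T.parent h).elim 1 z = T.reach z h := rfl
    simp [hr]
    field_simp
    ring
  refine hd.congr_fderiv ?_
  ext v
  have hLv : ∀ h, L h v = ∑ i, if T.parent h = some i then v i else 0 := by
    intro h
    rcases hp : T.parent h with _ | j <;> simp [L, hp, P]
  have hΩ : ∀ f : H → I → ℝ, ∑ h, ∑ i ∈ T.Ω h, f h i = ∑ i, f (T.infoset i) i := by
    intro f
    have h0 : ∀ h, ∑ i ∈ T.Ω h, f h i = ∑ i ∈ T.Ω h, f (T.infoset i) i := fun h =>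
      Finset.sum_congr rfl fun i hi => by rw [(Finset.mem_filter.1 hi).2]
    simp_rw [h0]
    exact Finset.sum_fiberwise Finset.univ T.infoset (fun i => f (T.infoset i) i)
  have hG : ∀ h, T.base h (fun i => z i / T.reach z (T.infoset i)) -
      ∑ j ∈ T.Ω h, baseGrad (fun i => z i / T.reach z (T.infoset i)) j *
        (z j / T.reach z (T.infoset j)) = -∑ i ∈ T.Ω h, (z i / T.reach z h) ^ 2 := by
    intro h
    unfold base baseGrad
    rw [← Finset.sum_sub_distrib, ← Finset.sum_neg_distrib]
    refine Finset.sum_congr rfl fun i hi => ?_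
    obtain rfl := (Finset.mem_filter.1 hi).2
    ring
  have hlhs : (∑ h, ∑ i ∈ T.Ω h, α h •
      ((2 * (z i / T.reach z h)) • P i - ((z i / T.reach z h) ^ 2) • L h)) v =
      ∑ h, ∑ i ∈ T.Ω h, α h * (2 * (z i / T.reach z h)) * v i +
      ∑ h, α h * (-∑ i ∈ T.Ω h, (z i / T.reach z h) ^ 2) * L h v := by
    simp only [_root_.sum_apply, ← Finset.sum_add_distrib]
    refine Finset.sum_congr rfl fun h _ => ?_
    rw [← Finset.sum_neg_distrib, Finset.mul_sum, Finset.sum_mul, ← Finset.sum_add_distrib]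
    refine Finset.sum_congr rfl fun i _ => ?_
    simp [P]
    ring
  rw [hlhs, hΩ]
  simp only [_root_.sum_apply, _root_.smul_apply,
    ContinuousLinearMap.proj_apply, smul_eq_mul, dilatedGrad, add_mul, hG, hLv,
    Finset.sum_add_distrib]
  congr 1
  · simp only [Finset.mul_sum, Finset.sum_mul, children, Finset.sum_filter]
    rw [Finset.sum_comm]
    refine Finset.sum_congr rfl fun i _ => Finset.sum_congr rfl fun h _ => ?_
    split <;> simp

end Single

/-- The Cartesian product of two treeplexes; no parent is changed. -/
def prod {M N HX HY : Type*} (TX : Treeplex M HX) (TY : Treeplex N HY) :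
    Treeplex (M ⊕ N) (HX ⊕ HY) where
  infoset := Sum.map TX.infoset TY.infoset
  parent := Sum.elim (fun h => (TX.parent h).map Sum.inl) (fun h => (TY.parent h).map Sum.inr)
  infoset_surjective := TX.infoset_surjective.sumMap TY.infoset_surjective
  acyclic := by
    refine ⟨?_⟩
    rintro (h | h)
    · refine TX.acyclic.induction (C := fun h => Acc _ (Sum.inl h)) h fun h ih => ⟨_, ?_⟩
      rintro _ ⟨i, hi, rfl⟩
      obtain ⟨j, hj, rfl⟩ : ∃ j, TX.parent h = some j ∧ Sum.inl j = i := by simpa using hi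
      exact ih _ ⟨j, hj, rfl⟩
    · refine TY.acyclic.induction (C := fun h => Acc _ (Sum.inr h)) h fun h ih => ⟨_, ?_⟩
      rintro _ ⟨i, hi, rfl⟩
      obtain ⟨j, hj, rfl⟩ : ∃ j, TY.parent h = some j ∧ Sum.inr j = i := by simpa using hi
      exact ih _ ⟨j, hj, rfl⟩

end Treeplex

namespace EFG

variable {M N HX HY : Type*} [Fintype M] [Fintype N] [Fintype HX] [Fintype HY]
  [DecidableEq M] [DecidableEq N] [DecidableEq HX] [DecidableEq HY]

/-- The operator `F(z) = (A y, -Aᵀ x)` for `z = (x, y)`. -/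
def F (A : Matrix M N ℝ) (z : M ⊕ N → ℝ) : M ⊕ N → ℝ :=
  Sum.elim (A.mulVec (z ∘ Sum.inr)) (-(A.transpose.mulVec (z ∘ Sum.inl)))

/-- The regularized payoff `xᵀ A y + τ ψ(x) - τ ψ(y)`. -/
noncomputable def payoff (TX : Treeplex M HX) (TY : Treeplex N HY) (A : Matrix M N ℝ)
    (α : HX ⊕ HY → ℝ) (τ : ℝ) (x : M → ℝ) (y : N → ℝ) : ℝ :=
  x ⬝ᵥ A.mulVec y + τ * TX.dilated (α ∘ Sum.inl) x - τ * TY.dilated (α ∘ Sum.inr) y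

/-- `z = (x, y)` is a Nash equilibrium of the regularized `γ`-perturbed game, where the first player
minimizes and the second player maximizes the regularized payoff. -/
def IsNash (TX : Treeplex M HX) (TY : Treeplex N HY) (A : Matrix M N ℝ)
    (α : HX ⊕ HY → ℝ) (γ τ : ℝ) (z : M ⊕ N → ℝ) : Prop :=
  z ∘ Sum.inl ∈ TX.strategies γ ∧ z ∘ Sum.inr ∈ TY.strategies γ ∧
    (∀ x ∈ TX.strategies γ, payoff TX TY A α τ (z ∘ Sum.inl) (z ∘ Sum.inr) ≤
      payoff TX TY A α τ x (z ∘ Sum.inr)) ∧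
    ∀ y ∈ TY.strategies γ, payoff TX TY A α τ (z ∘ Sum.inl) y ≤
      payoff TX TY A α τ (z ∘ Sum.inl) (z ∘ Sum.inr)

/-- The value vectors `V^h(z)` of all information sets of both players, as one vector, when both
players play according to the conditional form `q`. -/
noncomputable def V (TX : Treeplex M HX) (TY : Treeplex N HY) (A : Matrix M N ℝ)
    (α : HX ⊕ HY → ℝ) (τ : ℝ) (q : M ⊕ N → ℝ) : M ⊕ N → ℝ :=
  (TX.prod TY).V (F A ((TX.prod TY).toSeq q)) (fun h => τ * α h) q

/-- The variation `δ_s^h = ‖V^h(z_{s+1/2}) - V^h(z_{s-1/2})‖ ^ 2`, where `qh s` is the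
conditional form of `z_{s+1/2}`. -/
noncomputable def variation (TX : Treeplex M HX) (TY : Treeplex N HY) (A : Matrix M N ℝ)
    (α : HX ⊕ HY → ℝ) (τ : ℝ) (qh : ℕ → M ⊕ N → ℝ) (s : ℕ) (h : HX ⊕ HY) : ℝ :=
  ∑ i ∈ (TX.prod TY).Ω h, (V TX TY A α τ (qh s) i - V TX TY A α τ (qh (s - 1)) i) ^ 2

/-- The adaptive stepsize `λ_t^h = √(κ + ∑_{s=1}^{t-1} δ_s^h)`. -/
noncomputable def stepsize (TX : Treeplex M HX) (TY : Treeplex N HY) (A : Matrix M N ℝ)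
    (α : HX ⊕ HY → ℝ) (τ κ : ℝ) (qh : ℕ → M ⊕ N → ℝ) (t : ℕ) (h : HX ⊕ HY) : ℝ :=
  √(κ + ∑ s ∈ Finset.Ico 1 t, variation TX TY A α τ qh s h)

/-- The sequences `q t` (conditional form of `z_t`) and `qh t` (conditional form of `z_{t+1/2}`)
are the iterates of Reg-CFR with the Euclidean base regularizer and hyper-parameter `κ` in the
`γ`-perturbed game. -/
structure IsRegCFR (TX : Treeplex M HX) (TY : Treeplex N HY) (A : Matrix M N ℝ)
    (α : HX ⊕ HY → ℝ) (γ τ κ : ℝ) (q qh : ℕ → M ⊕ N → ℝ) : Prop where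
  /-- `q_0` is uniform at every information set. -/
  init : ∀ i, q 0 i = 1 / (((TX.prod TY).Ω ((TX.prod TY).infoset i)).card : ℝ)
  /-- `q_{1/2}` is uniform at every information set. -/
  init_half : qh 0 = q 0
  /-- The update of `q_{t+1}`. -/
  step_mem : ∀ t h, q (t + 1) ∈ (TX.prod TY).simplex γ h
  step : ∀ t h, IsMinOn (fun p =>
      ∑ i ∈ (TX.prod TY).Ω h,
        (V TX TY A α τ (qh t) i + τ * α h * Treeplex.baseGrad (q t) i) * p i +
      stepsize TX TY A α τ κ qh t h * (TX.prod TY).baseBregman h p (q t) +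
      (stepsize TX TY A α τ κ qh (t + 1) h - stepsize TX TY A α τ κ qh t h) *
        (TX.prod TY).baseBregman h p (q 1))
    ((TX.prod TY).simplex γ h) (q (t + 1))
  /-- The update of `q_{t+3/2}`. -/
  step_half_mem : ∀ t h, qh (t + 1) ∈ (TX.prod TY).simplex γ h
  step_half : ∀ t h, IsMinOn (fun p =>
      ∑ i ∈ (TX.prod TY).Ω h,
        (V TX TY A α τ (qh t) i + τ * α h * Treeplex.baseGrad (q (t + 1)) i) * p i +
      stepsize TX TY A α τ κ qh (t + 1) h * (TX.prod TY).baseBregman h p (q (t + 1)))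
    ((TX.prod TY).simplex γ h) (qh (t + 1))

end EFG

/-!
Fix an information set `h` and put `c = τ α_h`, `g_t = V^h(z_{t+1/2})`. Reg-CFR at `h` is optimistic
mirror descent with the Euclidean regularizer, and its one-step inequality
(`OptimisticDescent.regret_step`) bounds the regularized regret of `q_{t+1/2}` against any `p` by a
telescoping sum, plus a multiple of `λ_{t+1} - λ_t`, minus the squared half steps. Because the
regularizer is linearized at `q_t`, the left-hand side also carries `c ‖p - q_t‖ ^ 2`, and this is
what yields the last iterate. Take for `p` the conditional form of the equilibrium, and sum over `h`
with the probabilities `z*_{σ(h)}`. By the regret decomposition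
(`Treeplex.sum_reach_mul_local_gap`) the local regrets add up to the equilibrium gaps of the
`z_{t+1/2}`, which are nonnegative, and by `Treeplex.dilatedBregman_eq` the distances add up to
`D_ψ(z*, z_t)`. So `τ ∑_t D_ψ(z*, z_t)` is at most `4 ∑_h z*_{σ(h)} λ_{T+1}^h` minus the weighted half
steps (`EFG.IsRegCFR.sum_dilatedBregman_le`), and the matter is the growth of the stepsizes. As the
value vectors are Lipschitz (`EFG.exists_V_lipschitz`), `(λ_{T+1}^h) ^ 2` is at most `κ` plus a multiple
of the total squared movement of the `q_{t+1/2}` at all information sets.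

If `γ > 0`, the weights `z*_{σ(h)}` are bounded below, and the negative half steps dominate the
movement: a square root of the movement minus a multiple of it is bounded
(`EFG.IsRegCFR.sum_dilatedBregman_le_const`).

If `γ = 0`, some weights may vanish, and the movement is bounded by `O(√T)` at every information set
without help from the equilibrium. One step has length `O(1 / λ_t)`, which is enough for `κ = √T`. For
a fixed `κ`, the regularization makes the updates contract, so that the movement at `h` is also
`O(1)` plus a multiple of the variation of the losses at `h`
(`OptimisticDescent.sum_move_le_variation`). As long as that variation is `O(√T)` this suffices, and
once it exceeds `√T` so does `λ_t ^ 2`, and each later step contributes `O(1 / √T)`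
(`OptimisticDescent.sum_move_le_sqrt`).
-/

open scoped RealInnerProductSpace

/-! ### Optimistic mirror descent with adaptive stepsizes -/

/-- The first-order optimality condition for minimizing a linear function plus squared distances to
two points over a convex set. -/
theorem inner_nonneg_of_isMinOn_quadratic {E : Type*} [NormedAddCommGroup E]
    [InnerProductSpace ℝ E] {K : Set E} (hK : Convex ℝ K) {v x y m : E} {a b : ℝ} (hm : m ∈ K)
    (hmin : IsMinOn (fun p => ⟪v, p⟫ + a * ‖p - x‖ ^ 2 + b * ‖p - y‖ ^ 2) K m) {p : E}
    (hp : p ∈ K) :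
    0 ≤ ⟪v + (2 * a) • (m - x) + (2 * b) • (m - y), p - m⟫ := by
  have key : ∀ s : ℝ, 0 < s → s ≤ 1 →
      0 ≤ ⟪v + (2 * a) • (m - x) + (2 * b) • (m - y), p - m⟫ + s * ((a + b) * ‖p - m‖ ^ 2) := by
    intro s hs hs1
    have hmem : m + s • (p - m) ∈ K := hK.add_smul_sub_mem hm hp ⟨hs.le, hs1⟩
    have h1 := isMinOn_iff.1 hmin _ hmem
    have e : ∀ w : E, ‖m + s • (p - m) - w‖ ^ 2 =
        ‖m - w‖ ^ 2 + 2 * s * ⟪m - w, p - m⟫ + s ^ 2 * ‖p - m‖ ^ 2 := by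
      intro w
      rw [show m + s • (p - m) - w = (m - w) + s • (p - m) by abel, norm_add_sq_real,
        inner_smul_right, norm_smul, mul_pow, Real.norm_eq_abs, sq_abs]
      ring
    simp only [e, inner_add_right, inner_smul_right] at h1
    simp only [inner_add_left, inner_smul_left, RCLike.conj_to_real]
    have h2 : 0 ≤ s * (⟪v, p - m⟫ + 2 * a * ⟪m - x, p - m⟫ + 2 * b * ⟪m - y, p - m⟫ +
        s * ((a + b) * ‖p - m‖ ^ 2)) := by linarith
    exact nonneg_of_mul_nonneg_right h2 hs
  have hlim : Tendsto (fun s : ℝ => ⟪v + (2 * a) • (m - x) + (2 * b) • (m - y), p - m⟫ +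
      s * ((a + b) * ‖p - m‖ ^ 2)) (𝓝[>] 0)
      (𝓝 (⟪v + (2 * a) • (m - x) + (2 * b) • (m - y), p - m⟫ + 0 * ((a + b) * ‖p - m‖ ^ 2))) :=
    ((continuous_const.add (continuous_id.mul continuous_const)).tendsto 0).mono_left
      nhdsWithin_le_nhds
  rw [zero_mul, add_zero] at hlim
  refine ge_of_tendsto hlim ?_
  filter_upwards [Ioo_mem_nhdsGT (zero_lt_one : (0 : ℝ) < 1)] with s hs
  exact key s hs.1 hs.2.le

/-- Two sequences `q t` and `qh t` (for the half step `t + 1 / 2`) produced by optimistic mirror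
descent in `K` with losses `g t + c ‖·‖ ^ 2`, where the regularizer is linearized at `q t`, and with
the adaptive stepsizes `lam t`. The two minimization steps are recorded through their variational
inequalities, and `K` is a set with the size of a probability simplex. Nothing is required of
`q 0`, which need not lie in `K`. -/
structure OptimisticDescent {E : Type*} [NormedAddCommGroup E] [InnerProductSpace ℝ E]
    (K : Set E) (c : ℝ) (lam : ℕ → ℝ) (g q qh : ℕ → E) : Prop where
  norm_le : ∀ p ∈ K, ‖p‖ ≤ 1
  diam : ∀ p ∈ K, ∀ p' ∈ K, ‖p - p'‖ ^ 2 ≤ 2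
  c_nonneg : 0 ≤ c
  two_c_le : 2 * c ≤ lam 1
  one_le : 1 ≤ lam 1
  lam_nonneg : ∀ t, 0 ≤ lam t
  lam_sq : ∀ t, lam (t + 2) ^ 2 = lam (t + 1) ^ 2 + ‖g (t + 1) - g t‖ ^ 2
  q_mem : ∀ t, q (t + 1) ∈ K
  q_vi : ∀ t, ∀ p ∈ K, 0 ≤ ⟪g t + (2 * c) • q t + (2 * lam t) • (q (t + 1) - q t) +
    (2 * (lam (t + 1) - lam t)) • (q (t + 1) - q 1), p - q (t + 1)⟫
  qh_mem : ∀ t, qh (t + 1) ∈ K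
  qh_vi : ∀ t, ∀ p ∈ K, 0 ≤ ⟪g t + (2 * c) • q (t + 1) +
    (2 * lam (t + 1)) • (qh (t + 1) - q (t + 1)), p - qh (t + 1)⟫

namespace OptimisticDescent

variable {E : Type*} [NormedAddCommGroup E] [InnerProductSpace ℝ E]
  {K : Set E} {c : ℝ} {lam : ℕ → ℝ} {g q qh : ℕ → E}

theorem lam_le_succ (S : OptimisticDescent K c lam g q qh) (t : ℕ) :
    lam (t + 1) ≤ lam (t + 2) := by
  refine le_of_sq_le_sq ?_ (S.lam_nonneg _)
  rw [S.lam_sq]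
  exact le_add_of_nonneg_right (sq_nonneg _)

theorem lam_one_le (S : OptimisticDescent K c lam g q qh) (t : ℕ) : lam 1 ≤ lam (t + 1) := by
  induction t with
  | zero => exact le_rfl
  | succ t ih => exact ih.trans (S.lam_le_succ t)

theorem one_le_lam (S : OptimisticDescent K c lam g q qh) (t : ℕ) : 1 ≤ lam (t + 1) :=
  S.one_le.trans (S.lam_one_le t)

theorem two_c_le_lam (S : OptimisticDescent K c lam g q qh) (t : ℕ) : 2 * c ≤ lam (t + 1) :=
  S.two_c_le.trans (S.lam_one_le t)

theorem lam_sub_le (S : OptimisticDescent K c lam g q qh) (t : ℕ) :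
    lam (t + 2) - lam (t + 1) ≤ ‖g (t + 1) - g t‖ := by
  have h1 := S.lam_sq t
  have h2 := S.one_le_lam t
  have h3 := S.lam_le_succ t
  have h4 := norm_nonneg (g (t + 1) - g t)
  have : lam (t + 2) ≤ lam (t + 1) + ‖g (t + 1) - g t‖ := by
    refine le_of_sq_le_sq ?_ (by linarith)
    nlinarith
  linarith

/-- The optimistic mirror descent inequality for one round. The term `c ‖p - q‖ ^ 2` on the left is
the gain from linearizing the regularizer at `q`: the slope of `‖·‖ ^ 2` at `q` in the direction from
`p` to `qh` is the difference of the values plus `‖p - q‖ ^ 2 - ‖qh - q‖ ^ 2`. -/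
theorem regret_step (S : OptimisticDescent K c lam g q qh) (t : ℕ) {p : E} (hp : p ∈ K) :
    ⟪g (t + 1), qh (t + 1) - p⟫ + c * (‖qh (t + 1)‖ ^ 2 - ‖p‖ ^ 2) + c * ‖p - q (t + 1)‖ ^ 2 ≤
      lam (t + 1) * ‖p - q (t + 1)‖ ^ 2 - lam (t + 2) * ‖p - q (t + 2)‖ ^ 2 +
      4 * (lam (t + 2) - lam (t + 1)) - (lam (t + 1) - c) * ‖qh (t + 1) - q (t + 1)‖ ^ 2 -
      lam (t + 1) / 2 * ‖q (t + 2) - qh (t + 1)‖ ^ 2 := by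
  have v1 := S.q_vi (t + 1) p hp
  have v2 := S.qh_vi t _ (S.q_mem (t + 1))
  have d1 := S.diam _ hp _ (S.q_mem 0)
  have d2 := S.diam _ (S.q_mem (t + 1)) _ (S.qh_mem t)
  have d3 : 0 ≤ ‖q (t + 2) - q 1‖ ^ 2 := sq_nonneg _
  have hl := S.lam_le_succ t
  have hl1 := S.one_le_lam t
  have hsq := S.lam_sq t
  -- `δ = λ'² - λ²` is at most `2 λ' (λ' - λ)`, so Young's inequality with weight `λ'` costs `λ' - λ`
  have hy : ⟪g (t + 1) - g t, qh (t + 1) - q (t + 2)⟫ ≤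
      lam (t + 2) / 2 * ‖q (t + 2) - qh (t + 1)‖ ^ 2 + (lam (t + 2) - lam (t + 1)) := by
    refine (real_inner_le_norm _ _).trans ?_
    rw [norm_sub_rev (qh (t + 1))]
    set a := ‖g (t + 1) - g t‖
    set b := ‖q (t + 2) - qh (t + 1)‖
    have hL : 0 < lam (t + 2) := by linarith
    refine le_of_mul_le_mul_left ?_ hL
    nlinarith [sq_nonneg (a - lam (t + 2) * b), sq_nonneg (lam (t + 2) - lam (t + 1))]
  have hd1 := mul_le_mul_of_nonneg_left d1 (sub_nonneg.2 hl)
  have hd2 := mul_le_mul_of_nonneg_left d2 (sub_nonneg.2 hl)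
  have hd3 := mul_nonneg (sub_nonneg.2 hl) d3
  simp only [show t + 1 + 1 = t + 2 from rfl, zero_add] at v1 v2 d1 d2 hd1 hd2 hy ⊢
  generalize lam (t + 2) = l' at *
  generalize lam (t + 1) = l at *
  generalize q (t + 2) = b at *
  generalize q (t + 1) = a at *
  generalize q 1 = o at *
  generalize qh (t + 1) = m at *
  generalize g (t + 1) = G' at *
  generalize g t = G at *
  simp only [inner_add_left, inner_sub_left, inner_sub_right, inner_smul_left,
    RCLike.conj_to_real, norm_sub_sq_real, real_inner_self_eq_norm_sq] at *
  simp only [real_inner_comm p a, real_inner_comm p b, real_inner_comm p o,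
    real_inner_comm a m, real_inner_comm b m, real_inner_comm o b] at *
  linarith


/-- The regret against `p`, together with the distances of the iterates to `p`, is at most a
multiple of the last stepsize, minus the squared lengths of all half steps. -/
theorem sum_regret_le (S : OptimisticDescent K c lam g q qh) {p : E} (hp : p ∈ K) (T : ℕ) :
    ∑ t ∈ Finset.range T, (⟪g (t + 1), qh (t + 1) - p⟫ + c * (‖qh (t + 1)‖ ^ 2 - ‖p‖ ^ 2)) +
      c * ∑ t ∈ Finset.range T, ‖p - q (t + 1)‖ ^ 2 ≤
      4 * lam (T + 1) - 1 / 2 * ∑ t ∈ Finset.range T,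
        (‖qh (t + 1) - q (t + 1)‖ ^ 2 + ‖q (t + 2) - qh (t + 1)‖ ^ 2) := by
  have h : ∑ t ∈ Finset.range T, (⟪g (t + 1), qh (t + 1) - p⟫ +
        c * (‖qh (t + 1)‖ ^ 2 - ‖p‖ ^ 2)) + c * ∑ t ∈ Finset.range T, ‖p - q (t + 1)‖ ^ 2 ≤
      lam 1 * ‖p - q 1‖ ^ 2 - lam (T + 1) * ‖p - q (T + 1)‖ ^ 2 + 4 * (lam (T + 1) - lam 1) -
      1 / 2 * ∑ t ∈ Finset.range T,
        (‖qh (t + 1) - q (t + 1)‖ ^ 2 + ‖q (t + 2) - qh (t + 1)‖ ^ 2) := by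
    induction T with
    | zero => simp
    | succ T ih =>
      have h1 := S.regret_step T hp
      have h2 := S.one_le_lam T
      have h3 := S.two_c_le_lam T
      have h4 : 0 ≤ (lam (T + 1) - c - 1 / 2) * ‖qh (T + 1) - q (T + 1)‖ ^ 2 :=
        mul_nonneg (by linarith) (sq_nonneg _)
      have h5 : 0 ≤ (lam (T + 1) / 2 - 1 / 2) * ‖q (T + 2) - qh (T + 1)‖ ^ 2 :=
        mul_nonneg (by linarith) (sq_nonneg _)
      simp only [Finset.sum_range_succ, show T + 1 + 1 = T + 2 from rfl]
      linarith
  have h1 := mul_le_mul_of_nonneg_left (S.diam p hp _ (S.q_mem 0)) (S.lam_nonneg 1)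
  have h2 := mul_nonneg (S.lam_nonneg (T + 1)) (sq_nonneg ‖p - q (T + 1)‖)
  have h3 := S.lam_nonneg 1
  simp only [zero_add] at h1
  linarith

/-- The half iterates move no more than the half steps allow. -/
theorem sum_move_le_half_steps {E : Type*} [NormedAddCommGroup E] {q qh : ℕ → E}
    (h0 : ‖qh 1 - qh 0‖ ^ 2 ≤ 2) (T : ℕ) :
    ∑ t ∈ Finset.range T, ‖qh (t + 1) - qh t‖ ^ 2 ≤ 2 + 2 * ∑ t ∈ Finset.range T,
      (‖qh (t + 1) - q (t + 1)‖ ^ 2 + ‖q (t + 2) - qh (t + 1)‖ ^ 2) := by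
  rcases T with _ | T
  · simp
  · rw [Finset.sum_range_succ']
    have h1 : ∑ t ∈ Finset.range T, ‖qh (t + 1 + 1) - qh (t + 1)‖ ^ 2 ≤ ∑ t ∈ Finset.range T,
        (2 * ‖qh (t + 2) - q (t + 2)‖ ^ 2 + 2 * ‖q (t + 2) - qh (t + 1)‖ ^ 2) := by
      refine Finset.sum_le_sum fun t _ => ?_
      rw [show qh (t + 1 + 1) - qh (t + 1) =
        (qh (t + 2) - q (t + 2)) + (q (t + 2) - qh (t + 1)) by abel]
      have := norm_add_le (qh (t + 2) - q (t + 2)) (q (t + 2) - qh (t + 1))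
      refine (pow_le_pow_left₀ (norm_nonneg _) this 2).trans ?_
      linarith [sq_nonneg (‖qh (t + 2) - q (t + 2)‖ - ‖q (t + 2) - qh (t + 1)‖)]
    have h2 : ∑ t ∈ Finset.range T, ‖qh (t + 2) - q (t + 2)‖ ^ 2 ≤
        ∑ t ∈ Finset.range (T + 1), ‖qh (t + 1) - q (t + 1)‖ ^ 2 := by
      rw [Finset.sum_range_succ']; exact le_add_of_nonneg_right (sq_nonneg _)
    have h3 : ∑ t ∈ Finset.range T, ‖q (t + 2) - qh (t + 1)‖ ^ 2 ≤
        ∑ t ∈ Finset.range (T + 1), ‖q (t + 2) - qh (t + 1)‖ ^ 2 := by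
      rw [Finset.sum_range_succ]; exact le_add_of_nonneg_right (sq_nonneg _)
    simp only [Finset.sum_add_distrib, ← Finset.mul_sum] at h1 ⊢
    simp only [zero_add]
    linarith

/-- Cauchy-Schwarz in the form in which it turns variational inequalities into bounds on steps. -/
theorem mul_norm_le_norm_of_inner {w x : E} {l : ℝ} (h : l * ‖x‖ ^ 2 ≤ ⟪w, x⟫) :
    l * ‖x‖ ≤ ‖w‖ := by
  rcases (norm_nonneg x).eq_or_lt with h0 | h0
  · rw [← h0, mul_zero]; exact norm_nonneg _
  · refine le_of_mul_le_mul_right ?_ h0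
    have := real_inner_le_norm w x
    nlinarith

theorem norm_sub_le (S : OptimisticDescent K c lam g q qh) {p p' : E} (hp : p ∈ K)
    (hp' : p' ∈ K) : ‖p - p'‖ ≤ 3 / 2 := by
  have := S.diam p hp p' hp'
  nlinarith [norm_nonneg (p - p')]

/-- Each half step moves by `O(1 / λ)`. -/
theorem lam_mul_half_step_le (S : OptimisticDescent K c lam g q qh) {G : ℝ}
    (hG : ∀ t, ‖g t‖ ≤ G) (t : ℕ) :
    lam (t + 1) * ‖qh (t + 1) - q (t + 1)‖ ≤ G + 2 * c := by
  have v := S.qh_vi t _ (S.q_mem t)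
  have h : (2 * lam (t + 1)) * ‖q (t + 1) - qh (t + 1)‖ ^ 2 ≤
      ⟪g t + (2 * c) • q (t + 1), q (t + 1) - qh (t + 1)⟫ := by
    rw [inner_add_left, inner_smul_left, ← neg_sub (q (t + 1)) (qh (t + 1)), inner_neg_left,
      real_inner_self_eq_norm_sq] at v
    simp only [RCLike.conj_to_real] at v
    linarith
  have h1 := mul_norm_le_norm_of_inner h
  have h2 := norm_add_le (g t) ((2 * c) • q (t + 1))
  rw [norm_smul, Real.norm_of_nonneg (by linarith [S.c_nonneg])] at h2
  have h3 := mul_le_mul_of_nonneg_left (S.norm_le _ (S.q_mem t))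
    (by linarith [S.c_nonneg] : 0 ≤ 2 * c)
  rw [norm_sub_rev]
  have := hG t
  have h5 := (norm_nonneg _).trans this
  have := mul_nonneg (S.lam_nonneg (t + 1)) (norm_nonneg (q (t + 1) - qh (t + 1)))
  linarith

/-- Each full step moves by `O(1 / λ)`. -/
theorem lam_mul_step_le (S : OptimisticDescent K c lam g q qh) {G : ℝ}
    (hG : ∀ t, ‖g t‖ ≤ G) (t : ℕ) :
    lam (t + 1) * ‖q (t + 2) - q (t + 1)‖ ≤ 5 * G + 2 * c := by
  have v := S.q_vi (t + 1) _ (S.q_mem t)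
  simp only [show t + 1 + 1 = t + 2 from rfl] at v
  set D := lam (t + 2) - lam (t + 1)
  have hD0 : 0 ≤ D := sub_nonneg.2 (S.lam_le_succ t)
  have h : (2 * lam (t + 1)) * ‖q (t + 1) - q (t + 2)‖ ^ 2 ≤
      ⟪g (t + 1) + (2 * c) • q (t + 1) + (2 * D) • (q (t + 2) - q 1), q (t + 1) - q (t + 2)⟫ := by
    rw [inner_add_left, inner_add_left _ ((2 * lam (t + 1)) • _),
      inner_smul_left _ _ (2 * lam (t + 1)), ← neg_sub (q (t + 1)) (q (t + 2)), inner_neg_left, real_inner_self_eq_norm_sq] at v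
    rw [inner_add_left]
    simp only [RCLike.conj_to_real] at v
    linarith
  have h1 := mul_norm_le_norm_of_inner h
  have h2 := norm_add₃_le (a := g (t + 1)) (b := (2 * c) • q (t + 1))
    (c := (2 * D) • (q (t + 2) - q 1))
  rw [norm_smul, norm_smul, Real.norm_of_nonneg (by linarith [S.c_nonneg]),
    Real.norm_of_nonneg (by linarith)] at h2
  have h3 := mul_le_mul_of_nonneg_left (S.norm_le _ (S.q_mem t))
    (by linarith [S.c_nonneg] : 0 ≤ 2 * c)
  have h4 := mul_le_mul_of_nonneg_left (S.norm_sub_le (S.q_mem (t + 1)) (S.q_mem 0))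
    (by linarith : 0 ≤ 2 * D)
  have h5 : D ≤ 2 * G := (S.lam_sub_le t).trans
    ((_root_.norm_sub_le _ _).trans (by linarith [hG t, hG (t + 1)]))
  simp only [zero_add, show t + 1 + 1 = t + 2 from rfl] at h4
  rw [norm_sub_rev]
  have := hG (t + 1)
  have h6 := (norm_nonneg _).trans this
  have := S.c_nonneg
  linarith

/-- Consecutive half iterates are within `O(1 / λ)` of each other. -/
theorem lam_sq_mul_move_le (S : OptimisticDescent K c lam g q qh) {G : ℝ}
    (hG : ∀ t, ‖g t‖ ≤ G) (t : ℕ) :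
    lam (t + 1) ^ 2 * ‖qh (t + 2) - qh (t + 1)‖ ^ 2 ≤ (7 * G + 6 * c) ^ 2 := by
  have h1 := S.lam_mul_half_step_le hG t
  have h2 := S.lam_mul_half_step_le hG (t + 1)
  have h3 := S.lam_mul_step_le hG t
  have h4 : ‖qh (t + 2) - qh (t + 1)‖ ≤ ‖qh (t + 2) - q (t + 2)‖ + ‖q (t + 2) - q (t + 1)‖ +
      ‖qh (t + 1) - q (t + 1)‖ := by
    rw [norm_sub_rev (qh (t + 1)) (q (t + 1)), show qh (t + 2) - qh (t + 1) =
      (qh (t + 2) - q (t + 2)) + (q (t + 2) - q (t + 1)) + (q (t + 1) - qh (t + 1)) by abel]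
    exact norm_add₃_le
  have h5 : lam (t + 1) * ‖qh (t + 2) - q (t + 2)‖ ≤ G + 2 * c :=
    (mul_le_mul_of_nonneg_right (S.lam_le_succ t) (norm_nonneg _)).trans h2
  have h6 := mul_le_mul_of_nonneg_left h4 (S.lam_nonneg (t + 1))
  rw [← mul_pow]
  refine pow_le_pow_left₀ (mul_nonneg (S.lam_nonneg _) (norm_nonneg _)) ?_ 2
  linarith

/-- The regularization contracts consecutive steps up to the variation of the losses. -/
theorem lam_mul_step_succ_le (S : OptimisticDescent K c lam g q qh) (t : ℕ) :
    lam (t + 2) * ‖q (t + 3) - q (t + 2)‖ ≤ (lam (t + 1) - c) * ‖q (t + 2) - q (t + 1)‖ +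
      2 * (‖g (t + 1) - g t‖ + ‖g (t + 2) - g (t + 1)‖) := by
  have v1 := S.q_vi (t + 2) _ (S.q_mem (t + 1))
  have v2 := S.q_vi (t + 1) _ (S.q_mem (t + 2))
  simp only [show t + 1 + 1 = t + 2 from rfl, show t + 2 + 1 = t + 3 from rfl] at v1 v2
  have hD := S.lam_sub_le t
  have hD' := S.lam_sub_le (t + 1)
  have hD0 : 0 ≤ lam (t + 2) - lam (t + 1) := sub_nonneg.2 (S.lam_le_succ t)
  have hD0' : 0 ≤ lam (t + 3) - lam (t + 2) := sub_nonneg.2 (S.lam_le_succ (t + 1))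
  simp only [show t + 1 + 1 = t + 2 from rfl, show t + 1 + 2 = t + 3 from rfl] at hD'
  set D := lam (t + 2) - lam (t + 1)
  set D' := lam (t + 3) - lam (t + 2)
  have h : (2 * lam (t + 2)) * ‖q (t + 3) - q (t + 2)‖ ^ 2 ≤
      ⟪(g (t + 1) - g (t + 2)) + (2 * (lam (t + 1) - c)) • (q (t + 2) - q (t + 1)) +
        (2 * D) • (q (t + 2) - q 1) + (2 * D') • (q 1 - q (t + 3)), q (t + 3) - q (t + 2)⟫ := by
    simp only [inner_add_left, inner_sub_left, inner_sub_right, inner_smul_left,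
      RCLike.conj_to_real, norm_sub_sq_real, real_inner_self_eq_norm_sq] at v1 v2 ⊢
    simp only [real_inner_comm (q (t + 2)) (q (t + 3))] at v1 v2 ⊢
    linarith
  have h1 := mul_norm_le_norm_of_inner h
  have h2 := (norm_add_le _ _).trans (add_le_add_left (norm_add₃_le (a := g (t + 1) - g (t + 2))
    (b := (2 * (lam (t + 1) - c)) • (q (t + 2) - q (t + 1)))
    (c := (2 * D) • (q (t + 2) - q 1))) ‖(2 * D') • (q 1 - q (t + 3))‖)
  have hc := S.two_c_le_lam t
  have hc0 := S.c_nonneg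
  rw [norm_smul, norm_smul, norm_smul, Real.norm_of_nonneg (by linarith),
    Real.norm_of_nonneg (by linarith), Real.norm_of_nonneg (by linarith),
    norm_sub_rev (g (t + 1))] at h2
  have h3 := mul_le_mul_of_nonneg_left (S.norm_sub_le (S.q_mem (t + 1)) (S.q_mem 0)) hD0
  have h4 := mul_le_mul_of_nonneg_left (S.norm_sub_le (S.q_mem 0) (S.q_mem (t + 2))) hD0'
  simp only [zero_add, show t + 1 + 1 = t + 2 from rfl, show t + 2 + 1 = t + 3 from rfl] at h3 h4
  have := norm_nonneg (g (t + 1) - g t)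
  have := norm_nonneg (g (t + 2) - g (t + 1))
  linarith

/-- The half iterate lies close to the full one when the last step was short. -/
theorem half_step_le (S : OptimisticDescent K c lam g q qh) (t : ℕ) :
    ‖qh (t + 2) - q (t + 2)‖ ≤ ‖q (t + 2) - q (t + 1)‖ + 2 * ‖g (t + 1) - g t‖ := by
  have v1 := S.qh_vi (t + 1) _ (S.q_mem (t + 1))
  have v2 := S.q_vi (t + 1) _ (S.qh_mem (t + 1))
  simp only [show t + 1 + 1 = t + 2 from rfl] at v1 v2
  have hD := S.lam_sub_le t
  have hD0 : 0 ≤ lam (t + 2) - lam (t + 1) := sub_nonneg.2 (S.lam_le_succ t)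
  set D := lam (t + 2) - lam (t + 1)
  have h : (2 * lam (t + 2)) * ‖qh (t + 2) - q (t + 2)‖ ^ 2 ≤
      ⟪(2 * (lam (t + 1) - c)) • (q (t + 2) - q (t + 1)) +
        (2 * D) • (q (t + 2) - q 1), qh (t + 2) - q (t + 2)⟫ := by
    simp only [inner_add_left, inner_sub_left, inner_sub_right, inner_smul_left,
      RCLike.conj_to_real, norm_sub_sq_real, real_inner_self_eq_norm_sq] at v1 v2 ⊢
    simp only [real_inner_comm (q (t + 2)) (qh (t + 2))] at v1 v2 ⊢
    linarith
  have h1 := mul_norm_le_norm_of_inner h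
  have h2 := norm_add_le ((2 * (lam (t + 1) - c)) • (q (t + 2) - q (t + 1)))
    ((2 * D) • (q (t + 2) - q 1))
  have hc := S.two_c_le_lam t
  have hc0 := S.c_nonneg
  rw [norm_smul, norm_smul, Real.norm_of_nonneg (by linarith),
    Real.norm_of_nonneg (by linarith)] at h2
  have h3 := mul_le_mul_of_nonneg_left (S.norm_sub_le (S.q_mem (t + 1)) (S.q_mem 0)) hD0
  simp only [zero_add, show t + 1 + 1 = t + 2 from rfl] at h3
  have hd := norm_nonneg (g (t + 1) - g t)
  have h5 := S.one_le_lam (t + 1)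
  have hl := S.lam_le_succ t
  have hu := norm_nonneg (q (t + 2) - q (t + 1))
  refine le_of_mul_le_mul_left ?_ (by linarith : 0 < lam (t + 2))
  have h6 : (lam (t + 1) - c) * ‖q (t + 2) - q (t + 1)‖ ≤ lam (t + 2) * ‖q (t + 2) - q (t + 1)‖ :=
    mul_le_mul_of_nonneg_right (by linarith) hu
  have h7 : 1 * ‖g (t + 1) - g t‖ ≤ lam (t + 2) * ‖g (t + 1) - g t‖ :=
    mul_le_mul_of_nonneg_right h5 hd
  linarith

/-- Summing the contraction: the squared steps are controlled by the variation of the losses. -/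
theorem sum_step_sq_le (S : OptimisticDescent K c lam g q qh) (n : ℕ) :
    c ^ 2 * ∑ t ∈ Finset.range n, ‖q (t + 2) - q (t + 1)‖ ^ 2 ≤
      2 * c * lam 1 + 16 * ∑ t ∈ Finset.range (n + 1), ‖g (t + 1) - g t‖ ^ 2 := by
  have step : ∀ t, c ^ 2 * ‖q (t + 2) - q (t + 1)‖ ^ 2 ≤
      c * (lam (t + 1) * ‖q (t + 2) - q (t + 1)‖ ^ 2 - lam (t + 2) * ‖q (t + 3) - q (t + 2)‖ ^ 2) +
        8 * (‖g (t + 1) - g t‖ ^ 2 + ‖g (t + 2) - g (t + 1)‖ ^ 2) := by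
    intro t
    have h := S.lam_mul_step_succ_le t
    have hl := S.lam_le_succ t
    have hc := S.two_c_le_lam t
    have hc0 := S.c_nonneg
    have hu' := norm_nonneg (q (t + 3) - q (t + 2))
    generalize ‖q (t + 3) - q (t + 2)‖ = u' at *
    generalize ‖q (t + 2) - q (t + 1)‖ = u at *
    generalize ‖g (t + 1) - g t‖ = d at *
    generalize ‖g (t + 2) - g (t + 1)‖ = d' at *
    generalize lam (t + 2) = l' at *
    generalize lam (t + 1) = l at *
    -- multiply the contraction by `c * u'`, then split `u * u'` and `u' * (d + d')` by Young
    have h1 := mul_le_mul_of_nonneg_left h (mul_nonneg hc0 hu')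
    have h2 : 0 ≤ c * (l - c) * (u - u') ^ 2 :=
      mul_nonneg (mul_nonneg hc0 (by linarith)) (sq_nonneg _)
    have h3 : 0 ≤ (c * u' - 2 * (d + d')) ^ 2 := sq_nonneg _
    have h4 : 0 ≤ c * (l' - l) * u' ^ 2 :=
      mul_nonneg (mul_nonneg hc0 (by linarith)) (sq_nonneg _)
    have h5 : 0 ≤ (d - d') ^ 2 := sq_nonneg _
    linarith
  have hsum : c ^ 2 * ∑ t ∈ Finset.range n, ‖q (t + 2) - q (t + 1)‖ ^ 2 ≤
      c * (lam 1 * ‖q 2 - q 1‖ ^ 2 - lam (n + 1) * ‖q (n + 2) - q (n + 1)‖ ^ 2) +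
        8 * (∑ t ∈ Finset.range n, ‖g (t + 1) - g t‖ ^ 2 +
          ∑ t ∈ Finset.range n, ‖g (t + 2) - g (t + 1)‖ ^ 2) := by
    induction n with
    | zero => simp
    | succ n ih =>
      simp only [Finset.sum_range_succ, mul_add]
      have := step n
      simp only [show n + 1 + 1 = n + 2 from rfl, show n + 1 + 2 = n + 3 from rfl]
      linarith
  have h1 : ∑ t ∈ Finset.range n, ‖g (t + 1) - g t‖ ^ 2 ≤
      ∑ t ∈ Finset.range (n + 1), ‖g (t + 1) - g t‖ ^ 2 := by
    rw [Finset.sum_range_succ]; exact le_add_of_nonneg_right (sq_nonneg _)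
  have h2 : ∑ t ∈ Finset.range n, ‖g (t + 2) - g (t + 1)‖ ^ 2 ≤
      ∑ t ∈ Finset.range (n + 1), ‖g (t + 1) - g t‖ ^ 2 := by
    rw [Finset.sum_range_succ']; exact le_add_of_nonneg_right (sq_nonneg _)
  have h3 := S.diam _ (S.q_mem 1) _ (S.q_mem 0)
  have h4 := mul_le_mul_of_nonneg_left h3 (mul_nonneg S.c_nonneg (S.lam_nonneg 1))
  have h5 : 0 ≤ c * (lam (n + 1) * ‖q (n + 2) - q (n + 1)‖ ^ 2) :=
    mul_nonneg S.c_nonneg (mul_nonneg (S.lam_nonneg _) (sq_nonneg _))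
  simp only [zero_add, show 1 + 1 = 2 from rfl] at h4
  linarith

/-- The total squared movement of the half iterates is controlled by the variation of the losses. -/
theorem sum_move_le_variation (S : OptimisticDescent K c lam g q qh) (hc : 0 < c)
    (h0 : ‖qh 1 - qh 0‖ ^ 2 ≤ 2) (n : ℕ) :
    ∑ t ∈ Finset.range n, ‖qh (t + 1) - qh t‖ ^ 2 ≤ (4 + 30 * lam 1 / c) +
      (240 / c ^ 2 + 48) * ∑ t ∈ Finset.range n, ‖g (t + 1) - g t‖ ^ 2 := by
  have hl := S.lam_nonneg 1
  have hconst : (0 : ℝ) ≤ 30 * lam 1 / c := by positivity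
  have hd2 := S.diam _ (S.qh_mem 1) _ (S.qh_mem 0)
  simp only [zero_add, show 1 + 1 = 2 from rfl] at hd2
  rcases n with _ | _ | n
  · simp only [Finset.range_zero, Finset.sum_empty, mul_zero]; linarith
  · have : 0 ≤ (240 / c ^ 2 + 48) * ∑ t ∈ Finset.range 1, ‖g (t + 1) - g t‖ ^ 2 := by positivity
    simp only [zero_add, Finset.sum_range_one] at this ⊢
    linarith
  · have step : ∀ s, ‖qh (s + 3) - qh (s + 2)‖ ^ 2 ≤
        9 * ‖q (s + 3) - q (s + 2)‖ ^ 2 + 6 * ‖q (s + 2) - q (s + 1)‖ ^ 2 +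
          24 * (‖g (s + 2) - g (s + 1)‖ ^ 2 + ‖g (s + 1) - g s‖ ^ 2) := by
      intro s
      have h1 := S.half_step_le s
      have h2 := S.half_step_le (s + 1)
      simp only [show s + 1 + 1 = s + 2 from rfl, show s + 1 + 2 = s + 3 from rfl] at h2
      have h4 : ‖qh (s + 3) - qh (s + 2)‖ ≤ ‖qh (s + 3) - q (s + 3)‖ + ‖q (s + 3) - q (s + 2)‖ +
          ‖qh (s + 2) - q (s + 2)‖ := by
        rw [norm_sub_rev (qh (s + 2)) (q (s + 2)), show qh (s + 3) - qh (s + 2) =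
          (qh (s + 3) - q (s + 3)) + (q (s + 3) - q (s + 2)) + (q (s + 2) - qh (s + 2)) by abel]
        exact norm_add₃_le
      have h5 := norm_nonneg (qh (s + 3) - qh (s + 2))
      generalize ‖q (s + 3) - q (s + 2)‖ = u' at *
      generalize ‖q (s + 2) - q (s + 1)‖ = u at *
      generalize ‖g (s + 1) - g s‖ = d at *
      generalize ‖g (s + 2) - g (s + 1)‖ = d' at *
      have h6 : ‖qh (s + 3) - qh (s + 2)‖ ≤ (u' + 2 * d') + u' + (u + 2 * d) := by linarith
      refine (pow_le_pow_left₀ h5 h6 2).trans ?_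
      have a1 := sq_nonneg ((u' + 2 * d') - u')
      have a2 := sq_nonneg ((u' + 2 * d') - (u + 2 * d))
      have a3 := sq_nonneg (u' - (u + 2 * d))
      have a4 := sq_nonneg (u' - 2 * d')
      have a5 := sq_nonneg (u - 2 * d)
      linarith
    have e1 : ∑ t ∈ Finset.range (n + 2), ‖qh (t + 1) - qh t‖ ^ 2 ≤
        4 + ∑ s ∈ Finset.range n, ‖qh (s + 3) - qh (s + 2)‖ ^ 2 := by
      rw [Finset.sum_range_succ', Finset.sum_range_succ']
      simp only [zero_add, show 1 + 1 = 2 from rfl]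
      simp only [add_assoc, show 1 + 1 = 2 from rfl, show 2 + 1 = 3 from rfl]
      linarith
    have e2 := Finset.sum_le_sum fun s (_ : s ∈ Finset.range n) => step s
    simp only [Finset.sum_add_distrib, ← Finset.mul_sum] at e2
    have hU := S.sum_step_sq_le (n + 1)
    simp only [show n + 1 + 1 = n + 2 from rfl] at hU
    have u1 : ∑ s ∈ Finset.range n, ‖q (s + 2) - q (s + 1)‖ ^ 2 ≤
        ∑ s ∈ Finset.range (n + 1), ‖q (s + 2) - q (s + 1)‖ ^ 2 := by
      rw [Finset.sum_range_succ]; exact le_add_of_nonneg_right (sq_nonneg _)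
    have u2 : ∑ s ∈ Finset.range n, ‖q (s + 3) - q (s + 2)‖ ^ 2 ≤
        ∑ s ∈ Finset.range (n + 1), ‖q (s + 2) - q (s + 1)‖ ^ 2 := by
      rw [Finset.sum_range_succ']; exact le_add_of_nonneg_right (sq_nonneg _)
    have w1 : ∑ s ∈ Finset.range n, ‖g (s + 1) - g s‖ ^ 2 ≤
        ∑ s ∈ Finset.range (n + 2), ‖g (s + 1) - g s‖ ^ 2 :=
      Finset.sum_le_sum_of_subset_of_nonneg (Finset.range_mono (by omega)) fun _ _ _ => sq_nonneg _
    have w2 : ∑ s ∈ Finset.range n, ‖g (s + 2) - g (s + 1)‖ ^ 2 ≤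
        ∑ s ∈ Finset.range (n + 2), ‖g (s + 1) - g s‖ ^ 2 := by
      refine le_trans ?_ (Finset.sum_le_sum_of_subset_of_nonneg
        (Finset.range_mono (by omega : n + 1 ≤ n + 2)) fun _ _ _ => sq_nonneg _)
      rw [Finset.sum_range_succ']; exact le_add_of_nonneg_right (sq_nonneg _)
    set U := ∑ s ∈ Finset.range (n + 1), ‖q (s + 2) - q (s + 1)‖ ^ 2
    set W := ∑ s ∈ Finset.range (n + 2), ‖g (s + 1) - g s‖ ^ 2
    have hU' : 15 * U ≤ 30 * lam 1 / c + 240 / c ^ 2 * W := by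
      have : 30 * lam 1 / c + 240 / c ^ 2 * W = 15 * (2 * c * lam 1 + 16 * W) / c ^ 2 := by
        field_simp
        ring
      rw [this, le_div_iff₀ (by positivity)]
      linarith
    linarith

theorem lam_sq_eq (S : OptimisticDescent K c lam g q qh) (t : ℕ) :
    lam (t + 1) ^ 2 = lam 1 ^ 2 + ∑ s ∈ Finset.range t, ‖g (s + 1) - g s‖ ^ 2 := by
  induction t with
  | zero => simp
  | succ t ih => rw [S.lam_sq, ih, Finset.sum_range_succ, add_assoc]

/-- The constant in `sum_move_le_sqrt`. -/
noncomputable def moveConst (c l G : ℝ) : ℝ :=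
  (4 + 30 * l / c) + (240 / c ^ 2 + 48) * (1 + 8 * G ^ 2) + (7 * G + 6 * c) ^ 2

/-- In `N` rounds the total squared movement is `O(√N)`, whatever the losses: either they vary
little, and then the regularization makes the iterates settle, or the stepsize has become large. -/
theorem sum_move_le_sqrt (S : OptimisticDescent K c lam g q qh) (hc : 0 < c)
    (h0 : ‖qh 1 - qh 0‖ ^ 2 ≤ 2) {G : ℝ} (hG : ∀ t, ‖g t‖ ≤ G) {N : ℕ} (hN : 1 ≤ N) :
    ∑ t ∈ Finset.range N, ‖qh (t + 1) - qh t‖ ^ 2 ≤ moveConst c (lam 1) G * √(N : ℝ) := by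
  set R := √(N : ℝ) with hR
  have hR1 : 1 ≤ R := Real.one_le_sqrt.2 (by exact_mod_cast hN)
  have hl := S.lam_nonneg 1
  have hG0 : 0 ≤ G := (norm_nonneg _).trans (hG 0)
  have hδ : ∀ t, ‖g (t + 1) - g t‖ ^ 2 ≤ 4 * G ^ 2 := by
    intro t
    have : ‖g (t + 1) - g t‖ ≤ 2 * G :=
      (_root_.norm_sub_le _ _).trans (by linarith [hG t, hG (t + 1)])
    calc _ ≤ (2 * G) ^ 2 := pow_le_pow_left₀ (norm_nonneg _) this 2
      _ = _ := by ring
  -- Either the variation is still below `R + 8 G ^ 2`, and controls all movement so far, or the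
  -- stepsize has been at least `√R` for the last step, which is then short.
  have key : ∀ n : ℕ, ∑ t ∈ Finset.range n, ‖qh (t + 1) - qh t‖ ^ 2 ≤
      (4 + 30 * lam 1 / c) + (240 / c ^ 2 + 48) * (R + 8 * G ^ 2) +
        n * ((7 * G + 6 * c) ^ 2 / R) := by
    intro n
    induction n with
    | zero => simp only [Finset.range_zero, Finset.sum_empty]; positivity
    | succ n ih =>
      by_cases hsmall : ∑ t ∈ Finset.range (n + 1), ‖g (t + 1) - g t‖ ^ 2 ≤ R + 8 * G ^ 2
      · have h1 := S.sum_move_le_variation hc h0 (n + 1)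
        have h2 := mul_le_mul_of_nonneg_left hsmall
          (by positivity : 0 ≤ 240 / c ^ 2 + 48)
        have h3 : 0 ≤ ((n + 1 : ℕ) : ℝ) * ((7 * G + 6 * c) ^ 2 / R) := by positivity
        linarith
      · push Not at hsmall
        rcases n with _ | n
        · have := hδ 0
          simp only [zero_add, Finset.sum_range_one] at hsmall this
          nlinarith
        · have h1 := hδ n
          have h2 := hδ (n + 1)
          rw [Finset.sum_range_succ, Finset.sum_range_succ] at hsmall
          have h3 := S.lam_sq_eq n
          have h4 : R ≤ lam (n + 1) ^ 2 := by nlinarith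
          have h5 := S.lam_sq_mul_move_le hG n
          have h6 : ‖qh (n + 2) - qh (n + 1)‖ ^ 2 ≤ (7 * G + 6 * c) ^ 2 / R := by
            rw [le_div_iff₀ (by linarith)]
            have := mul_le_mul_of_nonneg_right h4 (sq_nonneg ‖qh (n + 2) - qh (n + 1)‖)
            linarith
          rw [Finset.sum_range_succ]
          push_cast at ih ⊢
          simp only [show n + 1 + 1 = n + 2 from rfl]
          linarith
  have h1 := key N
  have h2 : (N : ℝ) * ((7 * G + 6 * c) ^ 2 / R) = (7 * G + 6 * c) ^ 2 * R := by
    have : (N : ℝ) = R * R := (Real.mul_self_sqrt (Nat.cast_nonneg N)).symm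
    rw [this]
    field_simp
  rw [h2] at h1
  refine h1.trans ?_
  unfold moveConst
  have h3 : (4 + 30 * lam 1 / c) * 1 ≤ (4 + 30 * lam 1 / c) * R :=
    mul_le_mul_of_nonneg_left hR1 (by positivity)
  have h4 : (240 / c ^ 2 + 48) * (8 * G ^ 2) * 1 ≤ (240 / c ^ 2 + 48) * (8 * G ^ 2) * R :=
    mul_le_mul_of_nonneg_left hR1 (by positivity)
  linarith

end OptimisticDescent

/-! ### Strategies, regret decomposition and Bregman divergence on a treeplex -/

namespace Treeplex

section Reach

variable {I H : Type*} (T : Treeplex I H)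

theorem reach_of_parent_eq_some {z : I → ℝ} {h : H} {i : I} (hp : T.parent h = some i) :
    T.reach z h = z i := by simp [reach, hp]

theorem reach_of_parent_eq_none {z : I → ℝ} {h : H} (hp : T.parent h = none) :
    T.reach z h = 1 := by simp [reach, hp]

/-- Induction from the roots downwards. -/
theorem induction_down {motive : H → Prop} (root : ∀ h, T.parent h = none → motive h)
    (child : ∀ h i, T.parent h = some i → motive (T.infoset i) → motive h) (h : H) :
    motive h := by
  refine T.acyclic.induction (C := motive) h fun h ih => ?_
  rcases hp : T.parent h with _ | i
  · exact root h hp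
  · exact child h i hp (ih _ ⟨i, hp, rfl⟩)

end Reach

section Single

set_option linter.unusedSectionVars false

variable {I H : Type*} [Fintype I] [Fintype H] [DecidableEq I] [DecidableEq H] (T : Treeplex I H)

/-- Induction from the leaves upwards. -/
theorem induction_up {motive : H → Prop}
    (step : ∀ h, (∀ i ∈ T.Ω h, ∀ h' ∈ T.children i, motive h') → motive h) (h : H) :
    motive h := by
  refine T.acyclic_swap.induction (C := motive) h fun h ih => step h ?_
  intro i hi h' hh'
  exact ih h' ⟨i, by simpa [children] using hh', by simpa [Ω] using hi⟩

theorem mem_Ω {i : I} {h : H} : i ∈ T.Ω h ↔ T.infoset i = h := by simp [Ω]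

theorem sum_Ω (f : H → I → ℝ) : ∑ h, ∑ i ∈ T.Ω h, f h i = ∑ i, f (T.infoset i) i := by
  have h0 : ∀ h, ∑ i ∈ T.Ω h, f h i = ∑ i ∈ T.Ω h, f (T.infoset i) i := fun h =>
    Finset.sum_congr rfl fun i hi => by rw [T.mem_Ω.1 hi]
  simp_rw [h0]
  exact Finset.sum_fiberwise Finset.univ T.infoset (fun i => f (T.infoset i) i)

/-- Regrouping a sum over children by information sets leaves out the roots, which are nobody's
child but are reached with weight one. -/
theorem sum_mul_sum_children (z : I → ℝ) (f : H → ℝ) :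
    ∑ i, z i * ∑ h ∈ T.children i, f h =
      ∑ h, T.reach z h * f h - ∑ h with T.parent h = none, f h := by
  rw [Finset.sum_filter, ← Finset.sum_sub_distrib]
  simp only [children, Finset.mul_sum, Finset.sum_filter]
  rw [Finset.sum_comm]
  refine Finset.sum_congr rfl fun h _ => ?_
  rcases hp : T.parent h with _ | j <;> simp [reach, hp]

theorem dilated_eq {z p : I → ℝ} (hz : ∀ i, z i = T.reach z (T.infoset i) * p i) (α : H → ℝ) :
    T.dilated α z = ∑ h, α h * T.reach z h * T.base h p := by
  refine Finset.sum_congr rfl fun h _ => ?_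
  by_cases h0 : T.reach z h = 0
  · simp [h0]
  · congr 1
    refine Finset.sum_congr rfl fun i hi => ?_
    have := hz i
    rw [T.mem_Ω.1 hi] at this
    simp only
    rw [this, mul_div_cancel_left₀ _ h0]

theorem sum_mul_eq_sum_reach {z p : I → ℝ} (hz : ∀ i, z i = T.reach z (T.infoset i) * p i)
    (f : I → ℝ) : ∑ i, z i * f i = ∑ h, T.reach z h * ∑ i ∈ T.Ω h, p i * f i := by
  simp_rw [Finset.mul_sum]
  rw [T.sum_Ω (fun h i => T.reach z h * (p i * f i))]
  exact Finset.sum_congr rfl fun i _ => by rw [← mul_assoc, ← hz i]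

/-- The Bregman divergence of the dilated regularizer is the weighted sum of the divergences at the
information sets, with weights given by the first argument. -/
theorem dilatedBregman_eq {z p : I → ℝ} (hz : ∀ i, z i = T.reach z (T.infoset i) * p i)
    (α : H → ℝ) (q : I → ℝ) :
    T.dilatedBregman α z q = ∑ h, α h * (T.reach z h * ∑ i ∈ T.Ω h, (p i - q i) ^ 2) := by
  -- The sum over the roots is the same for both points, so that it cancels in the difference.
  have hG : ∀ (w r : I → ℝ), (∀ i, w i = T.reach w (T.infoset i) * r i) →
      ∑ i, T.dilatedGrad α q i * w i =
        ∑ h, α h * T.reach w h * (∑ i ∈ T.Ω h, r i * (2 * q i) - T.base h q) +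
          ∑ h with T.parent h = none, α h * T.base h q := by
    intro w r hw
    have e : ∀ i, T.dilatedGrad α q i * w i = w i * (α (T.infoset i) * (2 * q i)) -
        w i * ∑ h ∈ T.children i, α h * T.base h q := by
      intro i
      have : ∑ h ∈ T.children i, α h * (T.base h q - ∑ j ∈ T.Ω h, baseGrad q j * q j) =
          - ∑ h ∈ T.children i, α h * T.base h q := by
        rw [← Finset.sum_neg_distrib]
        refine Finset.sum_congr rfl fun h _ => ?_
        have : ∑ j ∈ T.Ω h, baseGrad q j * q j = 2 * T.base h q := by
          rw [base, Finset.mul_sum]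
          exact Finset.sum_congr rfl fun j _ => by rw [baseGrad]; ring
        rw [this]; ring
      rw [dilatedGrad, this, baseGrad]
      ring
    simp_rw [e]
    rw [Finset.sum_sub_distrib, T.sum_mul_sum_children, T.sum_mul_eq_sum_reach hw,
      ← sub_add, ← Finset.sum_sub_distrib]
    congr 1
    refine Finset.sum_congr rfl fun h _ => ?_
    have : ∑ i ∈ T.Ω h, r i * (α (T.infoset i) * (2 * q i)) =
        α h * ∑ i ∈ T.Ω h, r i * (2 * q i) := by
      rw [Finset.mul_sum]
      exact Finset.sum_congr rfl fun i hi => by rw [T.mem_Ω.1 hi]; ring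
    rw [this]
    ring
  have hq := hG _ _ (T.toSeq_eq q)
  have hp := hG _ _ hz
  have hqq : ∀ h, ∑ i ∈ T.Ω h, q i * (2 * q i) - T.base h q = T.base h q := by
    intro h
    rw [base, ← Finset.sum_sub_distrib]
    exact Finset.sum_congr rfl fun i _ => by ring
  simp_rw [hqq] at hq
  unfold dilatedBregman
  simp_rw [mul_sub]
  rw [Finset.sum_sub_distrib, hq, hp, T.dilated_eq hz, T.dilated_eq (T.toSeq_eq q)]
  have : ∑ h, α h * (T.reach z h * ∑ i ∈ T.Ω h, (p i - q i) ^ 2) =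
      ∑ h, α h * T.reach z h * T.base h p -
        ∑ h, α h * T.reach z h * (∑ i ∈ T.Ω h, p i * (2 * q i) - T.base h q) := by
    rw [← Finset.sum_sub_distrib]
    refine Finset.sum_congr rfl fun h _ => ?_
    rw [← mul_sub, mul_assoc]
    congr 2
    rw [base, base, ← Finset.sum_sub_distrib, ← Finset.sum_sub_distrib]
    exact Finset.sum_congr rfl fun i _ => by ring
  rw [this]
  ring

/-- Regret decomposition: the loss gap between `toSeq q` and `z` is the sum over the information
sets of the local gaps between `q` and the conditional form of `z`, weighted by the probability
with which `z` reaches them. -/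
theorem sum_reach_mul_local_gap {z p : I → ℝ} (hz : ∀ i, z i = T.reach z (T.infoset i) * p i)
    (g : I → ℝ) (c : H → ℝ) (q : I → ℝ) :
    ∑ h, T.reach z h * (∑ i ∈ T.Ω h, T.V g c q i * (q i - p i) +
      c h * (T.base h q - T.base h p)) =
      ∑ i, g i * (T.toSeq q i - z i) + (T.dilated c (T.toSeq q) - T.dilated c z) := by
  have key : ∀ (w r : I → ℝ), (∀ i, w i = T.reach w (T.infoset i) * r i) →
      ∑ h, T.reach w h * (∑ i ∈ T.Ω h, T.V g c q i * (q i - r i) +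
        c h * (T.base h q - T.base h r)) =
      ∑ h with T.parent h = none, T.W g c q h - ∑ i, g i * w i - T.dilated c w := by
    intro w r hw
    have e1 : ∀ h, T.reach w h * (∑ i ∈ T.Ω h, T.V g c q i * (q i - r i) +
        c h * (T.base h q - T.base h r)) = T.reach w h * T.W g c q h -
        T.reach w h * ∑ i ∈ T.Ω h, r i * T.V g c q i - c h * T.reach w h * T.base h r := by
      intro h
      rw [T.W_eq]
      have : ∑ i ∈ T.Ω h, T.V g c q i * (q i - r i) =
          ∑ i ∈ T.Ω h, q i * T.V g c q i - ∑ i ∈ T.Ω h, r i * T.V g c q i := by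
        rw [← Finset.sum_sub_distrib]
        exact Finset.sum_congr rfl fun i _ => by ring
      rw [this]
      ring
    simp_rw [e1]
    rw [Finset.sum_sub_distrib, Finset.sum_sub_distrib, ← T.dilated_eq hw,
      ← T.sum_mul_eq_sum_reach hw]
    have e2 : ∑ i, w i * T.V g c q i = ∑ i, g i * w i +
        (∑ h, T.reach w h * T.W g c q h - ∑ h with T.parent h = none, T.W g c q h) := by
      rw [← T.sum_mul_sum_children, ← Finset.sum_add_distrib]
      exact Finset.sum_congr rfl fun i _ => by rw [V]; ring
    rw [e2]
    ring
  have h1 := key _ _ hz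
  have h2 := key _ _ (T.toSeq_eq q)
  simp only [sub_self, mul_zero, Finset.sum_const_zero, add_zero] at h2
  rw [h1]
  simp_rw [mul_sub]
  rw [Finset.sum_sub_distrib]
  linarith

theorem dilated_const_mul (τ : ℝ) (α : H → ℝ) (z : I → ℝ) :
    T.dilated (fun h => τ * α h) z = τ * T.dilated α z := by
  simp only [dilated, Finset.mul_sum]
  exact Finset.sum_congr rfl fun h _ => by ring

variable {T}

theorem reach_nonneg_of_mem {γ : ℝ} (hγ : 0 ≤ γ) {z : I → ℝ} (hz : z ∈ T.strategies γ) (h : H) :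
    0 ≤ T.reach z h := by
  induction h using T.induction_down with
  | root h hp => rw [T.reach_of_parent_eq_none hp]; exact zero_le_one
  | child h i hp ih =>
    rw [T.reach_of_parent_eq_some hp]
    exact (mul_nonneg hγ ih).trans (hz.1 i)

theorem nonneg_of_mem {γ : ℝ} (hγ : 0 ≤ γ) {z : I → ℝ} (hz : z ∈ T.strategies γ) (i : I) :
    0 ≤ z i := (mul_nonneg hγ (reach_nonneg_of_mem hγ hz _)).trans (hz.1 i)

theorem le_reach_of_mem {γ : ℝ} (hγ : 0 ≤ γ) {z : I → ℝ} (hz : z ∈ T.strategies γ) (i : I) :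
    z i ≤ T.reach z (T.infoset i) := by
  rw [← hz.2]
  exact Finset.single_le_sum (fun j _ => nonneg_of_mem hγ hz j) (T.mem_Ω.2 rfl)

theorem reach_le_one_of_mem {γ : ℝ} (hγ : 0 ≤ γ) {z : I → ℝ} (hz : z ∈ T.strategies γ) (h : H) :
    T.reach z h ≤ 1 := by
  induction h using T.induction_down with
  | root h hp => rw [T.reach_of_parent_eq_none hp]
  | child h i hp ih =>
    rw [T.reach_of_parent_eq_some hp]
    exact (le_reach_of_mem hγ hz i).trans ih

/-- The quotients `z_i / z_{σ(h)}` are a conditional form of a strategy; where `z_{σ(h)} = 0` they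
are junk, but `z_i` vanishes too. -/
theorem eq_reach_mul_div {γ : ℝ} (hγ : 0 ≤ γ) {z : I → ℝ} (hz : z ∈ T.strategies γ) (i : I) :
    z i = T.reach z (T.infoset i) * (z i / T.reach z (T.infoset i)) := by
  by_cases h0 : T.reach z (T.infoset i) = 0
  · have h1 := le_reach_of_mem hγ hz i
    have h2 := nonneg_of_mem hγ hz i
    rw [h0] at h1 ⊢
    linarith
  · rw [mul_div_cancel₀ _ h0]

theorem div_reach_mem_simplex {γ : ℝ} (hγ : 0 ≤ γ) {z : I → ℝ} (hz : z ∈ T.strategies γ) {h : H}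
    (h0 : T.reach z h ≠ 0) : (fun i => z i / T.reach z (T.infoset i)) ∈ T.simplex γ h := by
  have hpos : 0 < T.reach z h := lt_of_le_of_ne (reach_nonneg_of_mem hγ hz h) h0.symm
  refine ⟨fun i hi => ?_, ?_⟩
  · obtain rfl := T.mem_Ω.1 hi
    rw [le_div_iff₀ hpos]
    exact hz.1 i
  · rw [← div_self h0]
    nth_rw 1 [← hz.2 h]
    rw [Finset.sum_div]
    exact Finset.sum_congr rfl fun i hi => by simp only [T.mem_Ω.1 hi]

/-- In a perturbed treeplex every information set is reached with a probability bounded below. -/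
theorem exists_pos_le_reach (T : Treeplex I H) {γ : ℝ} (hγ : 0 < γ) :
    ∃ ε > 0, ∀ z ∈ T.strategies γ, ∀ h, ε ≤ T.reach z h := by
  have h1 : ∀ h, ∃ ε > 0, ∀ z ∈ T.strategies γ, ε ≤ T.reach z h := by
    intro h
    induction h using T.induction_down with
    | root h hp => exact ⟨1, one_pos, fun z _ => (T.reach_of_parent_eq_none hp).ge⟩
    | child h i hp ih =>
      obtain ⟨ε, hε, hle⟩ := ih
      refine ⟨γ * ε, mul_pos hγ hε, fun z hz => ?_⟩
      rw [T.reach_of_parent_eq_some hp]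
      exact (mul_le_mul_of_nonneg_left (hle z hz) hγ.le).trans (hz.1 i)
  choose ε hε hle using h1
  rcases isEmpty_or_nonempty H with hH | hH
  · exact ⟨1, one_pos, fun z _ h => hH.elim h⟩
  · obtain ⟨h₀, hh₀⟩ := Finite.exists_min ε
    exact ⟨ε h₀, hε h₀, fun z hz h => (hh₀ h).trans (hle h z hz)⟩

theorem reachProb_of_parent_eq_some {I H : Type*} (T : Treeplex I H) (q : I → ℝ) {h : H} {i : I}
    (hp : T.parent h = some i) : T.reachProb q h = T.reachProb q (T.infoset i) * q i := by
  rw [← T.reach_toSeq, T.reach_of_parent_eq_some hp]; rfl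

theorem reachProb_of_parent_eq_none {I H : Type*} (T : Treeplex I H) (q : I → ℝ) {h : H}
    (hp : T.parent h = none) : T.reachProb q h = 1 := by
  rw [← T.reach_toSeq, T.reach_of_parent_eq_none hp]

theorem toSeq_mem_strategies {γ : ℝ} (hγ : 0 ≤ γ) {q : I → ℝ} (hq : ∀ h, q ∈ T.simplex γ h) :
    T.toSeq q ∈ T.strategies γ := by
  have hle : ∀ i, γ ≤ q i := fun i => (hq (T.infoset i)).1 i (T.mem_Ω.2 rfl)
  have h0 : ∀ h, 0 ≤ T.reachProb q h := by
    intro h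
    induction h using T.induction_down with
    | root h hp => rw [T.reachProb_of_parent_eq_none q hp]; exact zero_le_one
    | child h i hp ih =>
      rw [T.reachProb_of_parent_eq_some q hp]
      exact mul_nonneg ih (hγ.trans (hle i))
  refine ⟨fun i => ?_, fun h => ?_⟩
  · rw [T.toSeq_eq q i, T.reach_toSeq, mul_comm]
    exact mul_le_mul_of_nonneg_left (hle i) (h0 _)
  · rw [T.reach_toSeq]
    calc ∑ i ∈ T.Ω h, T.toSeq q i = ∑ i ∈ T.Ω h, T.reachProb q h * q i :=
          Finset.sum_congr rfl fun i hi => by rw [toSeq, T.mem_Ω.1 hi]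
      _ = T.reachProb q h := by rw [← Finset.mul_sum, (hq h).2, mul_one]

end Single

section Prod

set_option linter.unusedSectionVars false

variable {M N HX HY : Type*} [Fintype M] [Fintype N] [Fintype HX] [Fintype HY]
  [DecidableEq M] [DecidableEq N] [DecidableEq HX] [DecidableEq HY]
  (TX : Treeplex M HX) (TY : Treeplex N HY)

theorem reach_prod_inl (z : M ⊕ N → ℝ) (h : HX) :
    (TX.prod TY).reach z (Sum.inl h) = TX.reach (z ∘ Sum.inl) h := by
  rcases hp : TX.parent h with _ | i <;> simp [reach, prod, hp]

theorem reach_prod_inr (z : M ⊕ N → ℝ) (h : HY) :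
    (TX.prod TY).reach z (Sum.inr h) = TY.reach (z ∘ Sum.inr) h := by
  rcases hp : TY.parent h with _ | i <;> simp [reach, prod, hp]

theorem sum_Ω_prod_inl (h : HX) (f : M ⊕ N → ℝ) :
    ∑ i ∈ (TX.prod TY).Ω (Sum.inl h), f i = ∑ i ∈ TX.Ω h, f (Sum.inl i) := by
  simp only [Ω, Finset.sum_filter, Fintype.sum_sum_type]
  simp [prod]

theorem sum_Ω_prod_inr (h : HY) (f : M ⊕ N → ℝ) :
    ∑ i ∈ (TX.prod TY).Ω (Sum.inr h), f i = ∑ i ∈ TY.Ω h, f (Sum.inr i) := by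
  simp only [Ω, Finset.sum_filter, Fintype.sum_sum_type]
  simp [prod]

theorem mem_strategies_prod {γ : ℝ} {z : M ⊕ N → ℝ} :
    z ∈ (TX.prod TY).strategies γ ↔
      z ∘ Sum.inl ∈ TX.strategies γ ∧ z ∘ Sum.inr ∈ TY.strategies γ := by
  have e1 : ∀ i, (TX.prod TY).infoset (Sum.inl i) = Sum.inl (TX.infoset i) := fun _ => rfl
  have e2 : ∀ i, (TX.prod TY).infoset (Sum.inr i) = Sum.inr (TY.infoset i) := fun _ => rfl
  simp only [strategies, Set.mem_ofPred_eq, Sum.forall, e1, e2, reach_prod_inl, reach_prod_inr,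
    sum_Ω_prod_inl, sum_Ω_prod_inr, Function.comp_apply]
  tauto

theorem dilated_prod (α : HX ⊕ HY → ℝ) (z : M ⊕ N → ℝ) :
    (TX.prod TY).dilated α z =
      TX.dilated (α ∘ Sum.inl) (z ∘ Sum.inl) + TY.dilated (α ∘ Sum.inr) (z ∘ Sum.inr) := by
  simp [dilated, base, Fintype.sum_sum_type, reach_prod_inl, reach_prod_inr, sum_Ω_prod_inl,
    sum_Ω_prod_inr]

end Prod

end Treeplex

/-! ### Uniform Lipschitz bounds for the value vectors -/

/-- The functions `f θ`, `θ ∈ S`, are bounded on `Q` and Lipschitz on `Q`, with one constant for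
all parameters `θ ∈ S`. -/
def UniformlyLipschitz {Θ X : Type*} [PseudoMetricSpace X] (S : Set Θ) (Q : Set X)
    (f : Θ → X → ℝ) : Prop :=
  ∃ K : ℝ, ∀ θ ∈ S, ∀ x ∈ Q, |f θ x| ≤ K ∧ ∀ y ∈ Q, |f θ x - f θ y| ≤ K * dist x y

namespace UniformlyLipschitz

variable {Θ X : Type*} [PseudoMetricSpace X] {S : Set Θ} {Q : Set X} {f g : Θ → X → ℝ}

theorem of_bounded {a : Θ → ℝ} {B : ℝ} (ha : ∀ θ ∈ S, |a θ| ≤ B) :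
    UniformlyLipschitz S Q fun θ _ => a θ := by
  refine ⟨B, fun θ hθ x _ => ⟨ha θ hθ, fun y _ => ?_⟩⟩
  rw [sub_self, abs_zero]
  exact mul_nonneg ((abs_nonneg _).trans (ha θ hθ)) dist_nonneg

theorem add (hf : UniformlyLipschitz S Q f) (hg : UniformlyLipschitz S Q g) :
    UniformlyLipschitz S Q fun θ x => f θ x + g θ x := by
  obtain ⟨K, hK⟩ := hf
  obtain ⟨L, hL⟩ := hg
  refine ⟨K + L, fun θ hθ x hx => ⟨?_, fun y hy => ?_⟩⟩
  · exact (abs_add_le _ _).trans (add_le_add (hK θ hθ x hx).1 (hL θ hθ x hx).1)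
  · rw [add_sub_add_comm, add_mul]
    exact (abs_add_le _ _).trans (add_le_add ((hK θ hθ x hx).2 y hy) ((hL θ hθ x hx).2 y hy))

theorem mul (hf : UniformlyLipschitz S Q f) (hg : UniformlyLipschitz S Q g) :
    UniformlyLipschitz S Q fun θ x => f θ x * g θ x := by
  obtain ⟨K, hK⟩ := hf
  obtain ⟨L, hL⟩ := hg
  refine ⟨max (K * L) (2 * (K * L)), fun θ hθ x hx => ?_⟩
  have hK0 : 0 ≤ K := (abs_nonneg _).trans (hK θ hθ x hx).1
  have hL0 : 0 ≤ L := (abs_nonneg _).trans (hL θ hθ x hx).1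
  refine ⟨le_max_of_le_left ?_, fun y hy => ?_⟩
  · rw [abs_mul]
    exact mul_le_mul (hK θ hθ x hx).1 (hL θ hθ x hx).1 (abs_nonneg _) hK0
  · have e : f θ x * g θ x - f θ y * g θ y =
        f θ x * (g θ x - g θ y) + (f θ x - f θ y) * g θ y := by ring
    have h1 : |f θ x * (g θ x - g θ y)| ≤ K * (L * dist x y) := by
      rw [abs_mul]
      exact mul_le_mul (hK θ hθ x hx).1 ((hL θ hθ x hx).2 y hy) (abs_nonneg _) hK0
    have h2 : |(f θ x - f θ y) * g θ y| ≤ K * dist x y * L := by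
      rw [abs_mul]
      exact mul_le_mul ((hK θ hθ x hx).2 y hy) (hL θ hθ y hy).1 (abs_nonneg _)
        (mul_nonneg hK0 dist_nonneg)
    have h3 : 2 * (K * L) * dist x y ≤ max (K * L) (2 * (K * L)) * dist x y :=
      mul_le_mul_of_nonneg_right (le_max_right _ _) dist_nonneg
    rw [e]
    linarith [abs_add_le (f θ x * (g θ x - g θ y)) ((f θ x - f θ y) * g θ y)]

theorem neg (hf : UniformlyLipschitz S Q f) : UniformlyLipschitz S Q fun θ x => -f θ x := by
  obtain ⟨K, hK⟩ := hf
  refine ⟨K, fun θ hθ x hx => ⟨?_, fun y hy => ?_⟩⟩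
  · rw [abs_neg]; exact (hK θ hθ x hx).1
  · rw [← neg_sub', abs_neg]; exact (hK θ hθ x hx).2 y hy

theorem sum {ι : Type*} {s : Finset ι} {f : ι → Θ → X → ℝ}
    (hf : ∀ i ∈ s, UniformlyLipschitz S Q (f i)) :
    UniformlyLipschitz S Q fun θ x => ∑ i ∈ s, f i θ x := by
  classical
  induction s using Finset.induction_on with
  | empty =>
    simp only [Finset.sum_empty]
    exact of_bounded (B := 0) fun θ _ => by rw [abs_zero]
  | insert a s ha ih =>
    simp only [Finset.sum_insert ha]
    exact (hf a (Finset.mem_insert_self a s)).add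
      (ih fun i hi => hf i (Finset.mem_insert_of_mem hi))

/-- Finitely many families have a common constant. -/
theorem exists_forall {ι : Type*} [Finite ι] {f : ι → Θ → X → ℝ}
    (hf : ∀ i, UniformlyLipschitz S Q (f i)) :
    ∃ K : ℝ, 0 ≤ K ∧ ∀ θ ∈ S, ∀ x ∈ Q, ∀ i, |f i θ x| ≤ K ∧
      ∀ y ∈ Q, |f i θ x - f i θ y| ≤ K * dist x y := by
  choose K hK using hf
  obtain ⟨B, hB⟩ := (Set.finite_range K).bddAbove
  refine ⟨max B 0, le_max_right _ _, fun θ hθ x hx i => ?_⟩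
  have hi : K i ≤ max B 0 := (hB ⟨i, rfl⟩).trans (le_max_left _ _)
  refine ⟨(hK i θ hθ x hx).1.trans hi, fun y hy => ((hK i θ hθ x hx).2 y hy).trans ?_⟩
  exact mul_le_mul_of_nonneg_right hi dist_nonneg

end UniformlyLipschitz

namespace Treeplex

set_option linter.unusedSectionVars false

variable {I H : Type*} [Fintype I] [Fintype H] [DecidableEq I] [DecidableEq H] (T : Treeplex I H)

/-- The conditional forms: vectors that are a probability distribution at every information set. -/
def conditional : Set (I → ℝ) := {q | ∀ h, q ∈ T.simplex 0 h}

theorem simplex_mono {γ : ℝ} (hγ : 0 ≤ γ) {h : H} {q : I → ℝ} (hq : q ∈ T.simplex γ h) :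
    q ∈ T.simplex 0 h := ⟨fun i hi => hγ.trans (hq.1 i hi), hq.2⟩

theorem le_one_of_mem_simplex {h : H} {q : I → ℝ} (hq : q ∈ T.simplex 0 h) {i : I}
    (hi : i ∈ T.Ω h) : q i ≤ 1 := by
  rw [← hq.2]
  exact Finset.single_le_sum hq.1 hi

theorem abs_le_one_of_mem_conditional {q : I → ℝ} (hq : q ∈ T.conditional) (i : I) :
    |q i| ≤ 1 := by
  have hi : i ∈ T.Ω (T.infoset i) := T.mem_Ω.2 rfl
  rw [abs_of_nonneg ((hq _).1 i hi)]
  exact T.le_one_of_mem_simplex (hq _) hi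

theorem uniformlyLipschitz_apply {Θ : Type*} (S : Set Θ) (i : I) :
    UniformlyLipschitz S T.conditional fun _ q => q i := by
  refine ⟨1, fun θ _ q hq => ⟨T.abs_le_one_of_mem_conditional hq i, fun q' _ => ?_⟩⟩
  rw [one_mul, ← Real.dist_eq]
  exact dist_le_pi_dist q q' i

theorem uniformlyLipschitz_reachProb {Θ : Type*} (S : Set Θ) (h : H) :
    UniformlyLipschitz S T.conditional fun _ q => T.reachProb q h := by
  induction h using T.induction_down with
  | root h hp =>
    simp only [T.reachProb_of_parent_eq_none _ hp]
    exact .of_bounded (B := 1) fun θ _ => by rw [abs_one]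
  | child h i hp ih =>
    simp only [T.reachProb_of_parent_eq_some _ hp]
    exact ih.mul (T.uniformlyLipschitz_apply S i)

theorem uniformlyLipschitz_toSeq {Θ : Type*} (S : Set Θ) (i : I) :
    UniformlyLipschitz S T.conditional fun _ q => T.toSeq q i :=
  (T.uniformlyLipschitz_reachProb S _).mul (T.uniformlyLipschitz_apply S i)

theorem uniformlyLipschitz_W {Θ : Type*} {S : Set Θ} {g : Θ → (I → ℝ) → I → ℝ} {c : Θ → H → ℝ}
    {B : ℝ} (hg : ∀ i, UniformlyLipschitz S T.conditional fun θ q => g θ q i)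
    (hc : ∀ θ ∈ S, ∀ h, |c θ h| ≤ B) (h : H) :
    UniformlyLipschitz S T.conditional fun θ q => T.W (g θ q) (c θ) q h := by
  induction h using T.induction_up with
  | step h ih =>
    simp only [T.W_eq _ _ _ h, V, base, pow_two]
    refine .add (.sum fun i hi => (T.uniformlyLipschitz_apply S i).mul
      ((hg i).add (.sum fun h' hh' => ih i hi h' hh'))) (.mul (.of_bounded fun θ hθ => hc θ hθ h) ?_)
    exact .sum fun i _ => (T.uniformlyLipschitz_apply S i).mul (T.uniformlyLipschitz_apply S i)

theorem uniformlyLipschitz_V {Θ : Type*} {S : Set Θ} {g : Θ → (I → ℝ) → I → ℝ} {c : Θ → H → ℝ}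
    {B : ℝ} (hg : ∀ i, UniformlyLipschitz S T.conditional fun θ q => g θ q i)
    (hc : ∀ θ ∈ S, ∀ h, |c θ h| ≤ B) (i : I) :
    UniformlyLipschitz S T.conditional fun θ q => T.V (g θ q) (c θ) q i :=
  (hg i).add (.sum fun h' _ => T.uniformlyLipschitz_W hg hc h')

end Treeplex

namespace EFG

variable {M N HX HY : Type*} [Fintype M] [Fintype N] [Fintype HX] [Fintype HY]
  [DecidableEq M] [DecidableEq N] [DecidableEq HX] [DecidableEq HY]

/-- The value vectors are bounded and Lipschitz in the conditional form, uniformly over all payoff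
matrices with entries in `[-1, 1]` and all bounded regularization weights. -/
theorem exists_V_lipschitz (TX : Treeplex M HX) (TY : Treeplex N HY) (α : HX ⊕ HY → ℝ) (B : ℝ) :
    ∃ K : ℝ, 0 ≤ K ∧ ∀ A : Matrix M N ℝ, (∀ i j, |A i j| ≤ 1) →
      ∀ τ : ℝ, (∀ h, |τ * α h| ≤ B) → ∀ q ∈ (TX.prod TY).conditional, ∀ i,
        |V TX TY A α τ q i| ≤ K ∧ ∀ q' ∈ (TX.prod TY).conditional,
          |V TX TY A α τ q i - V TX TY A α τ q' i| ≤ K * dist q q' := by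
  let S : Set (Matrix M N ℝ × ℝ) := {θ | (∀ i j, |θ.1 i j| ≤ 1) ∧ ∀ h, |θ.2 * α h| ≤ B}
  have hF : ∀ i, UniformlyLipschitz S (TX.prod TY).conditional
      fun θ q => F θ.1 ((TX.prod TY).toSeq q) i := by
    rintro (i | j)
    · simp only [F, Sum.elim_inl, Matrix.mulVec, dotProduct, Function.comp_apply]
      exact .sum fun j _ => .mul (.of_bounded (B := 1) fun θ hθ => hθ.1 i j)
        (Treeplex.uniformlyLipschitz_toSeq _ S _)
    · simp only [F, Sum.elim_inr, Matrix.mulVec, dotProduct, Function.comp_apply, Pi.neg_apply,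
        Matrix.transpose_apply]
      exact .neg (.sum fun i _ => .mul (.of_bounded (B := 1) fun θ hθ => hθ.1 i j)
        (Treeplex.uniformlyLipschitz_toSeq _ S _))
  obtain ⟨K, hK0, hK⟩ := UniformlyLipschitz.exists_forall fun i =>
    (TX.prod TY).uniformlyLipschitz_V (c := fun θ h => θ.2 * α h) hF (fun θ hθ h => hθ.2 h) i
  exact ⟨K, hK0, fun A hA τ hτ q hq i => hK (A, τ) ⟨hA, hτ⟩ q hq i⟩

end EFG

/-! ### Reg-CFR as mirror descent at every information set -/

namespace Treeplex

set_option linter.unusedSectionVars false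

variable {I H : Type*} [Fintype I] [Fintype H] [DecidableEq I] [DecidableEq H] (T : Treeplex I H)

/-- The coordinates of `p` at the information set `h`, as a vector of a Euclidean space. -/
noncomputable def vec (h : H) (p : I → ℝ) : EuclideanSpace ℝ (T.Ω h) :=
  WithLp.toLp 2 fun i => p i

theorem inner_vec (h : H) (p r : I → ℝ) : ⟪T.vec h p, T.vec h r⟫ = ∑ i ∈ T.Ω h, p i * r i := by
  rw [PiLp.inner_apply, ← Finset.sum_coe_sort (T.Ω h)]
  exact Finset.sum_congr rfl fun i _ => by simp [vec, mul_comm]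

theorem vec_sub (h : H) (p r : I → ℝ) : T.vec h p - T.vec h r = T.vec h (p - r) := rfl

theorem vec_add (h : H) (p r : I → ℝ) : T.vec h p + T.vec h r = T.vec h (p + r) := rfl

theorem vec_smul (h : H) (a : ℝ) (p : I → ℝ) : a • T.vec h p = T.vec h (a • p) := rfl

theorem norm_vec_sq (h : H) (p : I → ℝ) : ‖T.vec h p‖ ^ 2 = T.base h p := by
  rw [← real_inner_self_eq_norm_sq, inner_vec]
  exact Finset.sum_congr rfl fun i _ => (pow_two _).symm

theorem norm_vec_sub_sq (h : H) (p r : I → ℝ) :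
    ‖T.vec h p - T.vec h r‖ ^ 2 = ∑ i ∈ T.Ω h, (p i - r i) ^ 2 := by
  rw [vec_sub, norm_vec_sq]; rfl

theorem baseBregman_eq (h : H) (p r : I → ℝ) :
    T.baseBregman h p r = ‖T.vec h p - T.vec h r‖ ^ 2 := by
  rw [norm_vec_sub_sq, baseBregman, base, base, ← Finset.sum_sub_distrib, ← Finset.sum_sub_distrib]
  exact Finset.sum_congr rfl fun i _ => by rw [baseGrad]; ring

theorem convex_vec_simplex (γ : ℝ) (h : H) : Convex ℝ (T.vec h '' T.simplex γ h) := by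
  rintro _ ⟨p, hp, rfl⟩ _ ⟨r, hr, rfl⟩ a b ha hb hab
  refine ⟨a • p + b • r, ⟨fun i hi => ?_, ?_⟩, by rw [vec_smul, vec_smul, vec_add]⟩
  · have h1 := mul_le_mul_of_nonneg_left (hp.1 i hi) ha
    have h2 := mul_le_mul_of_nonneg_left (hr.1 i hi) hb
    have h3 : γ = a * γ + b * γ := by rw [← add_mul, hab, one_mul]
    simp only [Pi.add_apply, Pi.smul_apply, smul_eq_mul]
    linarith
  · simp only [Pi.add_apply, Pi.smul_apply, smul_eq_mul, Finset.sum_add_distrib,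
      ← Finset.mul_sum, hp.2, hr.2, mul_one, hab]

theorem base_le_one {h : H} {p : I → ℝ} (hp : p ∈ T.simplex 0 h) : T.base h p ≤ 1 := by
  rw [← hp.2]
  refine Finset.sum_le_sum fun i hi => ?_
  have h0 := hp.1 i hi
  have h1 := T.le_one_of_mem_simplex hp hi
  nlinarith

theorem norm_vec_le_one {h : H} {p : I → ℝ} (hp : p ∈ T.simplex 0 h) : ‖T.vec h p‖ ≤ 1 := by
  have h1 := T.base_le_one hp
  rw [← norm_vec_sq] at h1
  nlinarith [norm_nonneg (T.vec h p)]

theorem norm_vec_sub_sq_le_two {h : H} {p r : I → ℝ} (hp : p ∈ T.simplex 0 h)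
    (hr : r ∈ T.simplex 0 h) : ‖T.vec h p - T.vec h r‖ ^ 2 ≤ 2 := by
  have h1 := T.base_le_one hp
  have h2 := T.base_le_one hr
  have h3 : 0 ≤ ⟪T.vec h p, T.vec h r⟫ := by
    rw [inner_vec]
    exact Finset.sum_nonneg fun i hi => mul_nonneg (hp.1 i hi) (hr.1 i hi)
  rw [norm_sub_sq_real, norm_vec_sq, norm_vec_sq]
  linarith

theorem dist_sq_le_sum_norm_vec_sq (p r : I → ℝ) :
    dist p r ^ 2 ≤ ∑ h, ‖T.vec h p - T.vec h r‖ ^ 2 := by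
  simp_rw [norm_vec_sub_sq]
  rw [T.sum_Ω fun _ i => (p i - r i) ^ 2]
  have h0 : 0 ≤ ∑ i, (p i - r i) ^ 2 := Finset.sum_nonneg fun _ _ => sq_nonneg _
  refine (Real.le_sqrt dist_nonneg h0).1 ((dist_pi_le_iff (Real.sqrt_nonneg _)).2 fun i => ?_)
  rw [Real.dist_eq]
  refine Real.abs_le_sqrt ?_
  exact Finset.single_le_sum (f := fun i => (p i - r i) ^ 2) (fun _ _ => sq_nonneg _)
    (Finset.mem_univ i)

/-- A vector whose coordinates are bounded by `b` has squared norm at most `|I| b ^ 2` at every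
information set. -/
theorem norm_vec_sq_le {b : ℝ} {p : I → ℝ} (hp : ∀ i, |p i| ≤ b) (h : H) :
    ‖T.vec h p‖ ^ 2 ≤ Fintype.card I * b ^ 2 := by
  rw [norm_vec_sq, base]
  calc ∑ i ∈ T.Ω h, p i ^ 2 ≤ ∑ i, p i ^ 2 :=
        Finset.sum_le_sum_of_subset_of_nonneg (Finset.subset_univ _) fun _ _ _ => sq_nonneg _
    _ ≤ ∑ _i : I, b ^ 2 := Finset.sum_le_sum fun i _ => by
        rw [← sq_abs]; exact pow_le_pow_left₀ (abs_nonneg _) (hp i) 2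
    _ = Fintype.card I * b ^ 2 := by simp

theorem mem_conditional_of_uniform {q : I → ℝ}
    (hq : ∀ i, q i = 1 / ((T.Ω (T.infoset i)).card : ℝ)) : q ∈ T.conditional := by
  intro h
  refine ⟨fun i _ => by rw [hq]; positivity, ?_⟩
  obtain ⟨i₀, hi₀⟩ := T.infoset_surjective h
  have hne : ((T.Ω h).card : ℝ) ≠ 0 := by
    have : (T.Ω h).Nonempty := ⟨i₀, T.mem_Ω.2 hi₀⟩
    exact_mod_cast this.card_pos.ne'
  calc ∑ i ∈ T.Ω h, q i = ∑ i ∈ T.Ω h, 1 / ((T.Ω h).card : ℝ) :=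
        Finset.sum_congr rfl fun i hi => by rw [hq, T.mem_Ω.1 hi]
    _ = 1 := by rw [Finset.sum_const, nsmul_eq_mul, mul_one_div_cancel hne]

end Treeplex

namespace EFG

set_option linter.unusedSectionVars false

variable {M N HX HY : Type*} [Fintype M] [Fintype N] [Fintype HX] [Fintype HY]
  [DecidableEq M] [DecidableEq N] [DecidableEq HX] [DecidableEq HY]
  {TX : Treeplex M HX} {TY : Treeplex N HY} {A : Matrix M N ℝ} {α : HX ⊕ HY → ℝ} {γ τ κ : ℝ}
  {q qh : ℕ → M ⊕ N → ℝ} {zs : M ⊕ N → ℝ}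

/-- In a zero-sum game the loss of a strategy against the equilibrium is nonnegative. -/
theorem IsNash.gap_nonneg (hN : IsNash TX TY A α γ τ zs) {z : M ⊕ N → ℝ}
    (hz : z ∈ (TX.prod TY).strategies γ) :
    0 ≤ ∑ i, F A z i * (z i - zs i) +
      ((TX.prod TY).dilated (fun h => τ * α h) z -
        (TX.prod TY).dilated (fun h => τ * α h) zs) := by
  obtain ⟨-, -, hx, hy⟩ := hN
  obtain ⟨hzx, hzy⟩ := (Treeplex.mem_strategies_prod TX TY).1 hz
  have h1 := (hy _ hzy).trans (hx _ hzx)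
  have hdot : ∀ w : M ⊕ N → ℝ, ∑ i, F A z i * w i =
      (w ∘ Sum.inl) ⬝ᵥ A.mulVec (z ∘ Sum.inr) - (z ∘ Sum.inl) ⬝ᵥ A.mulVec (w ∘ Sum.inr) := by
    intro w
    rw [Fintype.sum_sum_type, Matrix.dotProduct_mulVec (z ∘ Sum.inl), ← Matrix.mulVec_transpose]
    simp only [F, Sum.elim_inl, Sum.elim_inr, Pi.neg_apply, neg_mul, Finset.sum_neg_distrib,
      dotProduct, Function.comp_apply, ← sub_eq_add_neg]
    congr 1
    exact Finset.sum_congr rfl fun i _ => mul_comm _ _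
  simp_rw [mul_sub]
  rw [Finset.sum_sub_distrib, hdot, hdot, Treeplex.dilated_const_mul, Treeplex.dilated_const_mul,
    Treeplex.dilated_prod, Treeplex.dilated_prod]
  unfold payoff at h1
  linarith

theorem IsNash.dilatedBregman_nonneg (hN : IsNash TX TY A α γ τ zs) (hγ : 0 ≤ γ)
    (hα : ∀ h, 0 < α h) (p : M ⊕ N → ℝ) : 0 ≤ (TX.prod TY).dilatedBregman α zs p := by
  have hzs : zs ∈ (TX.prod TY).strategies γ :=
    (Treeplex.mem_strategies_prod TX TY).2 ⟨hN.1, hN.2.1⟩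
  rw [Treeplex.dilatedBregman_eq _ (Treeplex.eq_reach_mul_div hγ hzs)]
  exact Finset.sum_nonneg fun h _ => mul_nonneg (hα h).le
    (mul_nonneg (Treeplex.reach_nonneg_of_mem hγ hzs h) (Finset.sum_nonneg fun _ _ => sq_nonneg _))

theorem stepsize_sq (hκ : 0 ≤ κ) (t : ℕ) (h : HX ⊕ HY) :
    stepsize TX TY A α τ κ qh t h ^ 2 =
      κ + ∑ s ∈ Finset.Ico 1 t, variation TX TY A α τ qh s h := by
  refine Real.sq_sqrt (add_nonneg hκ (Finset.sum_nonneg fun s _ => ?_))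
  exact Finset.sum_nonneg fun i _ => sq_nonneg _

theorem stepsize_one (h : HX ⊕ HY) : stepsize TX TY A α τ κ qh 1 h = √κ := by
  simp [stepsize]

namespace IsRegCFR

theorem half_mem_conditional (R : IsRegCFR TX TY A α γ τ κ q qh) (hγ : 0 ≤ γ) (t : ℕ) :
    qh t ∈ (TX.prod TY).conditional := by
  cases t with
  | zero => rw [R.init_half]; exact Treeplex.mem_conditional_of_uniform _ R.init
  | succ t => exact fun h => Treeplex.simplex_mono _ hγ (R.step_half_mem t h)

theorem mem_conditional (R : IsRegCFR TX TY A α γ τ κ q qh) (hγ : 0 ≤ γ) (t : ℕ) :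
    q t ∈ (TX.prod TY).conditional := by
  cases t with
  | zero => exact Treeplex.mem_conditional_of_uniform _ R.init
  | succ t => exact fun h => Treeplex.simplex_mono _ hγ (R.step_mem t h)

/-- At every information set, Reg-CFR is optimistic mirror descent on the value vectors. -/
theorem optimisticDescent (R : IsRegCFR TX TY A α γ τ κ q qh) (hγ : 0 ≤ γ) (hκ : 1 ≤ κ)
    {h : HX ⊕ HY} (hc : 0 ≤ τ * α h) (hc2 : 2 * (τ * α h) ≤ √κ) :
    OptimisticDescent ((TX.prod TY).vec h '' (TX.prod TY).simplex γ h) (τ * α h)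
      (fun t => stepsize TX TY A α τ κ qh t h)
      (fun t => (TX.prod TY).vec h (V TX TY A α τ (qh t)))
      (fun t => (TX.prod TY).vec h (q t)) (fun t => (TX.prod TY).vec h (qh t)) where
  norm_le := by
    rintro _ ⟨p, hp, rfl⟩
    exact Treeplex.norm_vec_le_one _ (Treeplex.simplex_mono _ hγ hp)
  diam := by
    rintro _ ⟨p, hp, rfl⟩ _ ⟨r, hr, rfl⟩
    exact Treeplex.norm_vec_sub_sq_le_two _ (Treeplex.simplex_mono _ hγ hp)
      (Treeplex.simplex_mono _ hγ hr)
  c_nonneg := hc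
  two_c_le := by rw [stepsize_one]; exact hc2
  one_le := by rw [stepsize_one]; exact Real.one_le_sqrt.2 hκ
  lam_nonneg t := Real.sqrt_nonneg _
  lam_sq t := by
    rw [stepsize_sq (by linarith), stepsize_sq (by linarith),
      Finset.sum_Ico_succ_top (by omega : 1 ≤ t + 1), Treeplex.norm_vec_sub_sq, ← add_assoc]
    rfl
  q_mem t := ⟨_, R.step_mem t h, rfl⟩
  q_vi t := by
    intro p hp
    refine inner_nonneg_of_isMinOn_quadratic (Treeplex.convex_vec_simplex _ γ h)
      ⟨_, R.step_mem t h, rfl⟩ (isMinOn_iff.2 ?_) hp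
    rintro _ ⟨r, hr, rfl⟩
    have h1 := isMinOn_iff.1 (R.step t h) r hr
    simp only [Treeplex.baseBregman_eq] at h1
    simp only [Treeplex.vec_smul, Treeplex.vec_add, Treeplex.inner_vec]
    convert h1 using 5 <;> simp [Treeplex.baseGrad] <;> ring
  qh_mem t := ⟨_, R.step_half_mem t h, rfl⟩
  qh_vi t := by
    intro p hp
    have := inner_nonneg_of_isMinOn_quadratic (b := 0) (y := 0)
      (v := (TX.prod TY).vec h (V TX TY A α τ (qh t)) +
        (2 * (τ * α h)) • (TX.prod TY).vec h (q (t + 1)))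
      (x := (TX.prod TY).vec h (q (t + 1))) (a := stepsize TX TY A α τ κ qh (t + 1) h)
      (Treeplex.convex_vec_simplex _ γ h) ⟨_, R.step_half_mem t h, rfl⟩ (isMinOn_iff.2 ?_) hp
    · simpa only [mul_zero, zero_smul, add_zero] using this
    · rintro _ ⟨r, hr, rfl⟩
      have h1 := isMinOn_iff.1 (R.step_half t h) r hr
      simp only [Treeplex.baseBregman_eq] at h1
      simp only [Treeplex.vec_smul, Treeplex.vec_add, Treeplex.inner_vec, zero_mul, add_zero]
      convert h1 using 5 <;> simp [Treeplex.baseGrad] <;> ring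

/-- Summing the local regrets with the reach probabilities of the equilibrium: the regret terms add
up to nonnegative equilibrium gaps, and what is left bounds the divergences. -/
theorem sum_dilatedBregman_le (R : IsRegCFR TX TY A α γ τ κ q qh) (hγ : 0 ≤ γ) (hκ : 1 ≤ κ)
    (hc : ∀ h, 0 ≤ τ * α h) (hc2 : ∀ h, 2 * (τ * α h) ≤ √κ)
    (hN : IsNash TX TY A α γ τ zs) (T : ℕ) :
    τ * ∑ t ∈ Finset.range T, (TX.prod TY).dilatedBregman α zs (q (t + 1)) ≤
      ∑ h, (TX.prod TY).reach zs h * (4 * stepsize TX TY A α τ κ qh (T + 1) h -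
        1 / 2 * ∑ t ∈ Finset.range T,
          (‖(TX.prod TY).vec h (qh (t + 1)) - (TX.prod TY).vec h (q (t + 1))‖ ^ 2 +
            ‖(TX.prod TY).vec h (q (t + 2)) - (TX.prod TY).vec h (qh (t + 1))‖ ^ 2)) := by
  set P := TX.prod TY with hP
  have hzs : zs ∈ P.strategies γ := (Treeplex.mem_strategies_prod TX TY).2 ⟨hN.1, hN.2.1⟩
  set p : M ⊕ N → ℝ := fun i => zs i / P.reach zs (P.infoset i) with hp
  have hzp : ∀ i, zs i = P.reach zs (P.infoset i) * p i := Treeplex.eq_reach_mul_div hγ hzs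
  have hlocal : ∀ h, P.reach zs h * (∑ t ∈ Finset.range T,
        (⟪P.vec h (V TX TY A α τ (qh (t + 1))), P.vec h (qh (t + 1)) - P.vec h p⟫ +
          (τ * α h) * (‖P.vec h (qh (t + 1))‖ ^ 2 - ‖P.vec h p‖ ^ 2)) +
        (τ * α h) * ∑ t ∈ Finset.range T, ‖P.vec h p - P.vec h (q (t + 1))‖ ^ 2) ≤
      P.reach zs h * (4 * stepsize TX TY A α τ κ qh (T + 1) h -
        1 / 2 * ∑ t ∈ Finset.range T, (‖P.vec h (qh (t + 1)) - P.vec h (q (t + 1))‖ ^ 2 +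
            ‖P.vec h (q (t + 2)) - P.vec h (qh (t + 1))‖ ^ 2)) := by
    intro h
    by_cases h0 : P.reach zs h = 0
    · rw [h0, zero_mul, zero_mul]
    · exact mul_le_mul_of_nonneg_left ((R.optimisticDescent hγ hκ (hc h) (hc2 h)).sum_regret_le
        ⟨p, Treeplex.div_reach_mem_simplex hγ hzs h0, rfl⟩ T)
        (Treeplex.reach_nonneg_of_mem hγ hzs h)
  have hgap : 0 ≤ ∑ h, P.reach zs h * ∑ t ∈ Finset.range T,
      (⟪P.vec h (V TX TY A α τ (qh (t + 1))), P.vec h (qh (t + 1)) - P.vec h p⟫ +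
        (τ * α h) * (‖P.vec h (qh (t + 1))‖ ^ 2 - ‖P.vec h p‖ ^ 2)) := by
    simp_rw [Finset.mul_sum]
    rw [Finset.sum_comm]
    refine Finset.sum_nonneg fun t _ => ?_
    have h1 := hN.gap_nonneg (Treeplex.toSeq_mem_strategies hγ (R.step_half_mem t))
    rw [← Treeplex.sum_reach_mul_local_gap _ hzp] at h1
    simp only [Treeplex.vec_sub, Treeplex.inner_vec, Treeplex.norm_vec_sq]
    exact h1
  have hD : τ * ∑ t ∈ Finset.range T, P.dilatedBregman α zs (q (t + 1)) =
      ∑ h, P.reach zs h * ((τ * α h) *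
        ∑ t ∈ Finset.range T, ‖P.vec h p - P.vec h (q (t + 1))‖ ^ 2) := by
    simp_rw [P.dilatedBregman_eq hzp, Treeplex.norm_vec_sub_sq, Finset.mul_sum]
    rw [Finset.sum_comm]
    exact Finset.sum_congr rfl fun h _ => Finset.sum_congr rfl fun t _ =>
      Finset.sum_congr rfl fun i _ => by ring
  rw [hD]
  have hsum := Finset.sum_le_sum fun h (_ : h ∈ Finset.univ) => hlocal h
  simp_rw [mul_add (P.reach zs _)] at hsum
  rw [Finset.sum_add_distrib] at hsum
  linarith

theorem dilatedBregman_le (R : IsRegCFR TX TY A α γ τ κ q qh) (hγ : 0 ≤ γ) (hα : ∀ h, 0 < α h)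
    (hN : IsNash TX TY A α γ τ zs) (t : ℕ) :
    (TX.prod TY).dilatedBregman α zs (q t) ≤ ∑ h, 2 * α h := by
  have hzs : zs ∈ (TX.prod TY).strategies γ :=
    (Treeplex.mem_strategies_prod TX TY).2 ⟨hN.1, hN.2.1⟩
  rw [Treeplex.dilatedBregman_eq _ (Treeplex.eq_reach_mul_div hγ hzs)]
  refine Finset.sum_le_sum fun h _ => ?_
  rw [mul_comm 2]
  refine mul_le_mul_of_nonneg_left ?_ (hα h).le
  by_cases h0 : (TX.prod TY).reach zs h = 0
  · rw [h0, zero_mul]; exact zero_le_two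
  · rw [← Treeplex.norm_vec_sub_sq, ← one_mul (2 : ℝ)]
    exact mul_le_mul (Treeplex.reach_le_one_of_mem hγ hzs h)
      (Treeplex.norm_vec_sub_sq_le_two _ (Treeplex.simplex_mono _ hγ
        (Treeplex.div_reach_mem_simplex hγ hzs h0)) (R.mem_conditional hγ t h))
      (sq_nonneg _) zero_le_one

theorem half_move_le_two (R : IsRegCFR TX TY A α γ τ κ q qh) (hγ : 0 ≤ γ) (t : ℕ)
    (h : HX ⊕ HY) :
    ‖(TX.prod TY).vec h (qh (t + 1)) - (TX.prod TY).vec h (qh t)‖ ^ 2 ≤ 2 :=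
  Treeplex.norm_vec_sub_sq_le_two _ (R.half_mem_conditional hγ (t + 1) h)
    (R.half_mem_conditional hγ t h)

/-- The stepsizes grow with the movement of the half iterates, through the Lipschitz constant of
the value vectors. -/
theorem stepsize_sq_le (R : IsRegCFR TX TY A α γ τ κ q qh) (hγ : 0 ≤ γ) (hκ : 1 ≤ κ) {K : ℝ}
    (hK : ∀ p ∈ (TX.prod TY).conditional, ∀ i, |V TX TY A α τ p i| ≤ K ∧
      ∀ p' ∈ (TX.prod TY).conditional, |V TX TY A α τ p i - V TX TY A α τ p' i| ≤ K * dist p p')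
    (T : ℕ) (h : HX ⊕ HY) :
    stepsize TX TY A α τ κ qh (T + 1) h ^ 2 ≤ κ + Fintype.card (M ⊕ N) * K ^ 2 *
      ∑ h', ∑ t ∈ Finset.range T,
        ‖(TX.prod TY).vec h' (qh (t + 1)) - (TX.prod TY).vec h' (qh t)‖ ^ 2 := by
  rw [stepsize_sq (by linarith), Finset.sum_Ico_eq_sum_range, Finset.sum_comm, Finset.mul_sum]
  refine add_le_add_right (Finset.sum_le_sum fun t _ => ?_) κ
  have h1 := (TX.prod TY).norm_vec_sq_le (b := K * dist (qh (t + 1)) (qh t))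
    (p := V TX TY A α τ (qh (t + 1)) - V TX TY A α τ (qh t))
    (fun i => (hK _ (R.half_mem_conditional hγ (t + 1)) i).2 _ (R.half_mem_conditional hγ t)) h
  rw [← Treeplex.vec_sub, Treeplex.norm_vec_sub_sq] at h1
  rw [variation, add_comm 1 t, Nat.add_sub_cancel]
  refine h1.trans ?_
  rw [mul_pow, ← mul_assoc]
  exact mul_le_mul_of_nonneg_left ((TX.prod TY).dist_sq_le_sum_norm_vec_sq _ _) (by positivity)

theorem norm_vec_V_le (R : IsRegCFR TX TY A α γ τ κ q qh) (hγ : 0 ≤ γ) {K : ℝ} (hK0 : 0 ≤ K)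
    (hK : ∀ p ∈ (TX.prod TY).conditional, ∀ i, |V TX TY A α τ p i| ≤ K) (h : HX ⊕ HY) (t : ℕ) :
    ‖(TX.prod TY).vec h (V TX TY A α τ (qh t))‖ ≤ Fintype.card (M ⊕ N) * K := by
  have h1 := (TX.prod TY).norm_vec_sq_le (hK _ (R.half_mem_conditional hγ t)) h
  refine le_of_sq_le_sq (h1.trans ?_) (by positivity)
  rw [mul_pow]
  refine mul_le_mul_of_nonneg_right ?_ (sq_nonneg K)
  exact_mod_cast Nat.le_self_pow two_ne_zero _

end IsRegCFR

end EFG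

/-! ### Growth of the stepsizes and convergence -/

theorem rpow_one_fourth_eq (T : ℕ) : (T : ℝ) ^ (1 / 4 : ℝ) = √√(T : ℝ) := by
  rw [Real.sqrt_eq_rpow, Real.sqrt_eq_rpow, ← Real.rpow_mul (Nat.cast_nonneg T)]
  norm_num

theorem sum_Icc_one_eq_sum_range (f : ℕ → ℝ) (T : ℕ) :
    ∑ t ∈ Finset.Icc 1 T, f t = ∑ t ∈ Finset.range T, f (t + 1) := by
  induction T with
  | zero => simp
  | succ T ih => rw [Finset.sum_Icc_succ_top (by omega), ih, Finset.sum_range_succ]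

/-- The smallest of `T` numbers is at most their average. -/
theorem exists_le_of_sum_le_rpow {f : ℕ → ℝ} {C τ : ℝ} {T : ℕ} (hT : 1 ≤ T)
    (h : ∑ t ∈ Finset.Icc 1 T, f t ≤ C * (T : ℝ) ^ (1 / 4 : ℝ) / τ) :
    ∃ t ∈ Finset.Icc 1 T, f t ≤ C / τ * (T : ℝ) ^ (-(3 / 4) : ℝ) := by
  refine Finset.exists_le_of_sum_le (Finset.nonempty_Icc.2 hT) (h.trans_eq ?_)
  have hT0 : (0 : ℝ) < T := by exact_mod_cast hT
  rw [Finset.sum_const, Nat.card_Icc, Nat.add_sub_cancel, nsmul_eq_mul,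
    show (1 / 4 : ℝ) = 1 + -(3 / 4) by norm_num, Real.rpow_add hT0, Real.rpow_one]
  ring

namespace EFG

variable {M N HX HY : Type*} [Fintype M] [Fintype N] [Fintype HX] [Fintype HY]
  [DecidableEq M] [DecidableEq N] [DecidableEq HX] [DecidableEq HY]
  {TX : Treeplex M HX} {TY : Treeplex N HY} {A : Matrix M N ℝ} {α : HX ⊕ HY → ℝ} {γ τ κ : ℝ}
  {q qh : ℕ → M ⊕ N → ℝ} {zs : M ⊕ N → ℝ}

/-- If every information set is reached with probability at least `ε`, the negative terms of the
regret bound absorb the stepsizes: a square root of the movement is at most a constant plus a small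
multiple of the movement. -/
theorem IsRegCFR.sum_dilatedBregman_le_const (R : IsRegCFR TX TY A α γ τ κ q qh) (hγ : 0 ≤ γ)
    (hκ : 1 ≤ κ) (hc : ∀ h, 0 ≤ τ * α h) (hc2 : ∀ h, 2 * (τ * α h) ≤ √κ)
    (hN : IsNash TX TY A α γ τ zs) {ε : ℝ} (hε : 0 < ε)
    (hreach : ∀ h, ε ≤ (TX.prod TY).reach zs h) {K : ℝ}
    (hK : ∀ p ∈ (TX.prod TY).conditional, ∀ i, |V TX TY A α τ p i| ≤ K ∧
      ∀ p' ∈ (TX.prod TY).conditional, |V TX TY A α τ p i - V TX TY A α τ p' i| ≤ K * dist p p')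
    {L n : ℝ} (hL : L = Fintype.card (M ⊕ N) * K ^ 2 + 1) (hn : n = Fintype.card (HX ⊕ HY))
    (T : ℕ) :
    τ * ∑ t ∈ Finset.range T, (TX.prod TY).dilatedBregman α zs (q (t + 1)) ≤
      ε / (4 * L) * (κ + 2 * n * L) + 16 * n ^ 2 * L / ε := by
  have hzs : zs ∈ (TX.prod TY).strategies γ :=
    (Treeplex.mem_strategies_prod TX TY).2 ⟨hN.1, hN.2.1⟩
  have hmain := R.sum_dilatedBregman_le hγ hκ hc hc2 hN T
  set Q : HX ⊕ HY → ℝ := fun h => ∑ t ∈ Finset.range T,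
    (‖(TX.prod TY).vec h (qh (t + 1)) - (TX.prod TY).vec h (q (t + 1))‖ ^ 2 +
      ‖(TX.prod TY).vec h (q (t + 2)) - (TX.prod TY).vec h (qh (t + 1))‖ ^ 2) with hQ
  have hQ0 : ∀ h, 0 ≤ Q h := fun h =>
    Finset.sum_nonneg fun t _ => add_nonneg (sq_nonneg _) (sq_nonneg _)
  have hL0 : 0 < L := by rw [hL]; positivity
  have hn0 : 0 ≤ n := by rw [hn]; positivity
  have hQs : 0 ≤ ∑ h, Q h := Finset.sum_nonneg fun h _ => hQ0 h
  set Λ := √(κ + L * (2 * n + 2 * ∑ h, Q h)) with hΛ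
  have hΛ2 : Λ ^ 2 = κ + L * (2 * n + 2 * ∑ h, Q h) := Real.sq_sqrt (by positivity)
  have hmove : ∑ h, ∑ t ∈ Finset.range T,
      ‖(TX.prod TY).vec h (qh (t + 1)) - (TX.prod TY).vec h (qh t)‖ ^ 2 ≤
        2 * n + 2 * ∑ h, Q h := by
    have h1 := Finset.sum_le_sum fun h (_ : h ∈ Finset.univ) =>
      OptimisticDescent.sum_move_le_half_steps (q := fun t => (TX.prod TY).vec h (q t))
        (qh := fun t => (TX.prod TY).vec h (qh t)) (R.half_move_le_two hγ 0 h) T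
    rw [Finset.sum_add_distrib, Finset.sum_const, Finset.card_univ, nsmul_eq_mul, ← hn,
      ← Finset.mul_sum] at h1
    linarith
  have hlam : ∀ h, stepsize TX TY A α τ κ qh (T + 1) h ≤ Λ := by
    intro h
    refine Real.le_sqrt_of_sq_le ((R.stepsize_sq_le hγ hκ hK T h).trans ?_)
    refine add_le_add_right (mul_le_mul (by rw [hL]; linarith) hmove ?_ hL0.le) κ
    exact Finset.sum_nonneg fun _ _ => Finset.sum_nonneg fun _ _ => sq_nonneg _
  have hterm : ∀ h, (TX.prod TY).reach zs h *
      (4 * stepsize TX TY A α τ κ qh (T + 1) h - 1 / 2 * Q h) ≤ 4 * Λ - ε / 2 * Q h := by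
    intro h
    have h1 : (TX.prod TY).reach zs h * stepsize TX TY A α τ κ qh (T + 1) h ≤ 1 * Λ :=
      mul_le_mul (Treeplex.reach_le_one_of_mem hγ hzs h) (hlam h) (Real.sqrt_nonneg _) zero_le_one
    have h2 := mul_le_mul_of_nonneg_right (hreach h) (hQ0 h)
    linarith
  have hsum := hmain.trans (Finset.sum_le_sum fun h _ => hterm h)
  rw [Finset.sum_sub_distrib, Finset.sum_const, Finset.card_univ, nsmul_eq_mul, ← hn,
    ← Finset.mul_sum] at hsum
  -- The weight `ε / (4 L)` makes the movement in `Λ ^ 2` cancel against the negative term.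
  have hamgm : n * (4 * Λ) ≤ ε / (4 * L) * Λ ^ 2 + 16 * n ^ 2 * L / ε := by
    have h1 : ε / (4 * L) * Λ ^ 2 + 16 * n ^ 2 * L / ε - n * (4 * Λ) =
        (ε * Λ - 8 * n * L) ^ 2 / (4 * L * ε) := by
      field_simp
      ring
    have h2 : 0 ≤ (ε * Λ - 8 * n * L) ^ 2 / (4 * L * ε) := by positivity
    linarith
  have hexp : ε / (4 * L) * Λ ^ 2 = ε / (4 * L) * (κ + 2 * n * L) + ε / 2 * ∑ h, Q h := by
    rw [hΛ2]
    field_simp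
    ring
  linarith

/-- If every information set moves by `O(√T)`, then the divergences add up to `O(T ^ (1 / 4) / τ)`,
whether or not the equilibrium reaches all information sets. -/
theorem IsRegCFR.sum_dilatedBregman_le_of_move (R : IsRegCFR TX TY A α γ τ κ q qh) (hγ : 0 ≤ γ)
    (hκ : 1 ≤ κ) (hc : ∀ h, 0 ≤ τ * α h) (hc2 : ∀ h, 2 * (τ * α h) ≤ √κ) (hτ : 0 < τ)
    (hN : IsNash TX TY A α γ τ zs) {K : ℝ}
    (hK : ∀ p ∈ (TX.prod TY).conditional, ∀ i, |V TX TY A α τ p i| ≤ K ∧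
      ∀ p' ∈ (TX.prod TY).conditional, |V TX TY A α τ p i - V TX TY A α τ p' i| ≤ K * dist p p')
    {T : ℕ} {κ' Q : ℝ} (hκ' : κ ≤ κ' * √(T : ℝ))
    (hmove : ∑ h, ∑ t ∈ Finset.range T,
      ‖(TX.prod TY).vec h (qh (t + 1)) - (TX.prod TY).vec h (qh t)‖ ^ 2 ≤ Q * √(T : ℝ)) :
    ∑ t ∈ Finset.Icc 1 T, (TX.prod TY).dilatedBregman α zs (q t) ≤
      (Fintype.card (HX ⊕ HY) * (4 * √(κ' + Fintype.card (M ⊕ N) * K ^ 2 * Q)) + 1) *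
        (T : ℝ) ^ (1 / 4 : ℝ) / τ := by
  have hzs : zs ∈ (TX.prod TY).strategies γ :=
    (Treeplex.mem_strategies_prod TX TY).2 ⟨hN.1, hN.2.1⟩
  have hmain := R.sum_dilatedBregman_le hγ hκ hc hc2 hN T
  rw [sum_Icc_one_eq_sum_range, rpow_one_fourth_eq, le_div_iff₀ hτ, mul_comm _ τ]
  refine hmain.trans ?_
  set B := κ' + Fintype.card (M ⊕ N) * K ^ 2 * Q
  have hlam : ∀ h, stepsize TX TY A α τ κ qh (T + 1) h ≤ √B * √√(T : ℝ) := by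
    intro h
    have h1 := R.stepsize_sq_le hγ hκ hK T h
    have h2 := mul_le_mul_of_nonneg_left hmove
      (by positivity : 0 ≤ Fintype.card (M ⊕ N) * K ^ 2)
    rw [← Real.sqrt_mul' _ (Real.sqrt_nonneg _)]
    refine Real.le_sqrt_of_sq_le ?_
    have h3 : B * √(T : ℝ) = κ' * √(T : ℝ) + Fintype.card (M ⊕ N) * K ^ 2 * (Q * √(T : ℝ)) := by
      ring
    linarith
  have hterm : ∀ h, (TX.prod TY).reach zs h * (4 * stepsize TX TY A α τ κ qh (T + 1) h -
      1 / 2 * ∑ t ∈ Finset.range T,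
        (‖(TX.prod TY).vec h (qh (t + 1)) - (TX.prod TY).vec h (q (t + 1))‖ ^ 2 +
          ‖(TX.prod TY).vec h (q (t + 2)) - (TX.prod TY).vec h (qh (t + 1))‖ ^ 2)) ≤
      4 * (√B * √√(T : ℝ)) := by
    intro h
    have h1 : (TX.prod TY).reach zs h * stepsize TX TY A α τ κ qh (T + 1) h ≤
        1 * (√B * √√(T : ℝ)) :=
      mul_le_mul (Treeplex.reach_le_one_of_mem hγ hzs h) (hlam h) (Real.sqrt_nonneg _) zero_le_one
    have h2 := mul_nonneg (Treeplex.reach_nonneg_of_mem hγ hzs h)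
      (Finset.sum_nonneg fun t (_ : t ∈ Finset.range T) => add_nonneg
        (sq_nonneg ‖(TX.prod TY).vec h (qh (t + 1)) - (TX.prod TY).vec h (q (t + 1))‖)
        (sq_nonneg ‖(TX.prod TY).vec h (q (t + 2)) - (TX.prod TY).vec h (qh (t + 1))‖))
    linarith
  refine (Finset.sum_le_sum fun h _ => hterm h).trans ?_
  rw [Finset.sum_const, Finset.card_univ, nsmul_eq_mul]
  have := Real.sqrt_nonneg √(T : ℝ)
  linarith

/-- With `κ = √T` all stepsizes are at least `T ^ (1 / 4)`, which alone limits the movement. -/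
theorem IsRegCFR.sum_move_le_of_tuned {T : ℕ} (hT : 1 ≤ T)
    (R : IsRegCFR TX TY A α γ τ (√(T : ℝ)) q qh) (hγ : 0 ≤ γ)
    {h : HX ⊕ HY} (hc : 0 ≤ τ * α h) (hc2 : 2 * (τ * α h) ≤ √√(T : ℝ)) {G B : ℝ}
    (hB : τ * α h ≤ B) (hG : ∀ t, ‖(TX.prod TY).vec h (V TX TY A α τ (qh t))‖ ≤ G) :
    ∑ t ∈ Finset.range T,
      ‖(TX.prod TY).vec h (qh (t + 1)) - (TX.prod TY).vec h (qh t)‖ ^ 2 ≤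
      (2 + (7 * G + 6 * B) ^ 2) * √(T : ℝ) := by
  have hκ : 1 ≤ √(T : ℝ) := Real.one_le_sqrt.2 (by exact_mod_cast hT)
  have S := R.optimisticDescent hγ hκ hc hc2
  have hG0 : 0 ≤ G := (norm_nonneg _).trans (hG 0)
  have hstep : ∀ t, ‖(TX.prod TY).vec h (qh (t + 2)) - (TX.prod TY).vec h (qh (t + 1))‖ ^ 2 ≤
      (7 * G + 6 * B) ^ 2 / √(T : ℝ) := by
    intro t
    rw [le_div_iff₀ (by linarith)]
    have h1 := S.lam_sq_mul_move_le hG t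
    have h2 := pow_le_pow_left₀ (S.lam_nonneg 1) (S.lam_one_le t) 2
    rw [stepsize_one, Real.sq_sqrt (by linarith)] at h2
    have h3 := mul_le_mul_of_nonneg_right h2
      (sq_nonneg ‖(TX.prod TY).vec h (qh (t + 2)) - (TX.prod TY).vec h (qh (t + 1))‖)
    have h4 : (7 * G + 6 * (τ * α h)) ^ 2 ≤ (7 * G + 6 * B) ^ 2 :=
      pow_le_pow_left₀ (by positivity) (by linarith) 2
    linarith
  obtain ⟨n, rfl⟩ : ∃ n, T = n + 1 := ⟨T - 1, by omega⟩
  rw [Finset.sum_range_succ']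
  have h1 := Finset.sum_le_sum fun t (_ : t ∈ Finset.range n) => hstep t
  rw [Finset.sum_const, Finset.card_range, nsmul_eq_mul] at h1
  have h2 := R.half_move_le_two hγ 0 h
  have h3 : (n : ℝ) * ((7 * G + 6 * B) ^ 2 / √((n + 1 : ℕ) : ℝ)) ≤
      (7 * G + 6 * B) ^ 2 * √((n + 1 : ℕ) : ℝ) := by
    rw [← mul_div_assoc, div_le_iff₀ (by linarith), mul_assoc,
      Real.mul_self_sqrt (Nat.cast_nonneg _), mul_comm]
    refine mul_le_mul_of_nonneg_left ?_ (sq_nonneg _)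
    push_cast
    linarith
  simp only [show ∀ t : ℕ, t + 1 + 1 = t + 2 from fun _ => rfl]
  linarith

end EFG

theorem theorem3 {M N HX HY : Type*} [Fintype M] [Fintype N] [Fintype HX] [Fintype HY]
    [DecidableEq M] [DecidableEq N] [DecidableEq HX] [DecidableEq HY]
    (TX : Treeplex M HX) (TY : Treeplex N HY) (α : HX ⊕ HY → ℝ) (hα : ∀ h, 0 < α h) :
    -- perturbed games: a constant independent of the horizon, of the payoffs and of `τ`
    (∀ γ κ : ℝ, 0 < γ → 1 ≤ κ → ∃ C > 0,
      ∀ A : Matrix M N ℝ, (∀ i j, |A i j| ≤ 1) →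
      ∀ τ : ℝ, 0 < τ → τ ≤ 1 / (2 * ‖α‖) →
      ∀ (q qh : ℕ → M ⊕ N → ℝ) (zs : M ⊕ N → ℝ),
        EFG.IsRegCFR TX TY A α γ τ κ q qh → EFG.IsNash TX TY A α γ τ zs →
        (∀ T : ℕ, ∑ t ∈ Finset.Icc 1 T, (TX.prod TY).dilatedBregman α zs (q t) ≤ C / τ) ∧
        Tendsto (fun t => (TX.prod TY).dilatedBregman α zs (q t)) atTop (𝓝 0)) ∧
    -- unperturbed games, with a hyper-parameter that does not depend on the horizon
    (∀ κ τ : ℝ, 1 ≤ κ → 0 < τ → 2 * τ * ‖α‖ ≤ √κ → ∃ C > 0,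
      ∀ A : Matrix M N ℝ, (∀ i j, |A i j| ≤ 1) →
      ∀ (q qh : ℕ → M ⊕ N → ℝ) (zs : M ⊕ N → ℝ),
        EFG.IsRegCFR TX TY A α 0 τ κ q qh → EFG.IsNash TX TY A α 0 τ zs →
        ∀ T : ℕ, 1 ≤ T →
          ∑ t ∈ Finset.Icc 1 T, (TX.prod TY).dilatedBregman α zs (q t) ≤
            C * (T : ℝ) ^ (1 / 4 : ℝ) / τ ∧
          ∃ t ∈ Finset.Icc 1 T, (TX.prod TY).dilatedBregman α zs (q t) ≤
            C / τ * (T : ℝ) ^ (-(3 / 4) : ℝ)) ∧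
    -- unperturbed games, with the hyper-parameter tuned to the horizon: uniform in `τ ∈ (0, 1]`
    (∃ C > 0,
      ∀ A : Matrix M N ℝ, (∀ i j, |A i j| ≤ 1) →
      ∀ τ : ℝ, 0 < τ → τ ≤ 1 →
      ∀ T : ℕ, 1 ≤ T →
      ∀ (q qh : ℕ → M ⊕ N → ℝ) (zs : M ⊕ N → ℝ),
        EFG.IsRegCFR TX TY A α 0 τ (√(T : ℝ)) q qh → EFG.IsNash TX TY A α 0 τ zs →
          ∑ t ∈ Finset.Icc 1 T, (TX.prod TY).dilatedBregman α zs (q t) ≤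
            C * (T : ℝ) ^ (1 / 4 : ℝ) / τ ∧
          ∃ t ∈ Finset.Icc 1 T, (TX.prod TY).dilatedBregman α zs (q t) ≤
            C / τ * (T : ℝ) ^ (-(3 / 4) : ℝ)) := by
  have hαn : ∀ h, α h ≤ ‖α‖ := fun h => (le_abs_self _).trans (norm_le_pi_norm α h)
  refine ⟨fun γ κ hγ hκ => ?_, fun κ τ hκ hτ hτκ => ?_, ?_⟩
  · obtain ⟨ε, hε, hreach⟩ := (TX.prod TY).exists_pos_le_reach hγ
    obtain ⟨K, -, hK⟩ := EFG.exists_V_lipschitz TX TY α (1 / 2)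
    obtain ⟨C, hC, hCeq⟩ : ∃ C > 0, C = ε / (4 * (Fintype.card (M ⊕ N) * K ^ 2 + 1)) *
        (κ + 2 * Fintype.card (HX ⊕ HY) * (Fintype.card (M ⊕ N) * K ^ 2 + 1)) +
        16 * (Fintype.card (HX ⊕ HY) : ℝ) ^ 2 * (Fintype.card (M ⊕ N) * K ^ 2 + 1) / ε :=
      ⟨_, by positivity, rfl⟩
    refine ⟨C, hC, fun A hA τ hτ hτα q qh zs R hN => ?_⟩
    have hzs := (Treeplex.mem_strategies_prod TX TY).2 ⟨hN.1, hN.2.1⟩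
    -- `1 / (2 * 0) = 0` leaves no `τ` when there is no information set
    have hα0 : 0 < ‖α‖ := by
      refine lt_of_le_of_ne (norm_nonneg α) fun h0 => ?_
      rw [← h0, mul_zero, div_zero] at hτα
      linarith
    have hcB : ∀ h, τ * α h ≤ 1 / 2 := by
      intro h
      rw [le_div_iff₀ (by positivity)] at hτα
      have := mul_le_mul_of_nonneg_left (hαn h) hτ.le
      linarith
    have hc : ∀ h, 0 ≤ τ * α h := fun h => mul_nonneg hτ.le (hα h).le
    have hc2 : ∀ h, 2 * (τ * α h) ≤ √κ := fun h => by
      linarith [hcB h, Real.one_le_sqrt.2 hκ]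
    have hbound : ∀ T : ℕ, ∑ t ∈ Finset.range T,
        (TX.prod TY).dilatedBregman α zs (q (t + 1)) ≤ C / τ := fun T => by
      rw [le_div_iff₀ hτ, mul_comm, hCeq]
      exact R.sum_dilatedBregman_le_const hγ.le hκ hc hc2 hN hε (hreach zs hzs)
        (hK A hA τ fun h => by rw [abs_of_nonneg (hc h)]; exact hcB h) rfl rfl T
    refine ⟨fun T => ?_, ?_⟩
    · rw [sum_Icc_one_eq_sum_range]
      exact hbound T
    · refine (tendsto_add_atTop_iff_nat 1).1 (Summable.tendsto_atTop_zero ?_)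
      exact summable_of_sum_range_le
        (fun t => hN.dilatedBregman_nonneg hγ.le hα _) hbound
  · have hc : ∀ h, 0 < τ * α h := fun h => mul_pos hτ (hα h)
    have hcB : ∀ h, τ * α h ≤ τ * ‖α‖ := fun h => mul_le_mul_of_nonneg_left (hαn h) hτ.le
    have hc2 : ∀ h, 2 * (τ * α h) ≤ √κ := fun h => by linarith [hcB h]
    obtain ⟨K, hK0, hK⟩ := EFG.exists_V_lipschitz TX TY α (τ * ‖α‖)
    refine ⟨Fintype.card (HX ⊕ HY) * (4 * √(κ + Fintype.card (M ⊕ N) * K ^ 2 *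
      ∑ h, OptimisticDescent.moveConst (τ * α h) √κ (Fintype.card (M ⊕ N) * K))) + 1,
      by positivity, fun A hA q qh zs R hN T hT => ?_⟩
    have hV := hK A hA τ fun h => by rw [abs_of_nonneg (hc h).le]; exact hcB h
    have hT1 : 1 ≤ √(T : ℝ) := Real.one_le_sqrt.2 (by exact_mod_cast hT)
    have hsum := R.sum_dilatedBregman_le_of_move le_rfl hκ (fun h => (hc h).le) hc2 hτ hN hV
      (T := T) (κ' := κ) (le_mul_of_one_le_right (by linarith) hT1)
      (Q := ∑ h, OptimisticDescent.moveConst (τ * α h) √κ (Fintype.card (M ⊕ N) * K)) (by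
        rw [Finset.sum_mul]
        refine Finset.sum_le_sum fun h _ => ?_
        have h1 := (R.optimisticDescent le_rfl hκ (hc h).le (hc2 h)).sum_move_le_sqrt (hc h)
          (R.half_move_le_two le_rfl 0 h)
          (R.norm_vec_V_le le_rfl hK0 (fun p hp i => (hV p hp i).1) h) hT
        rwa [EFG.stepsize_one] at h1)
    exact ⟨hsum, exists_le_of_sum_le_rpow hT hsum⟩
  · obtain ⟨K, hK0, hK⟩ := EFG.exists_V_lipschitz TX TY α ‖α‖
    set G : ℝ := Fintype.card (M ⊕ N) * K with hGdef
    set Q : ℝ := Fintype.card (HX ⊕ HY) * (2 + (7 * G + 6 * ‖α‖) ^ 2) with hQ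
    set C₁ : ℝ := Fintype.card (HX ⊕ HY) * (4 * √(1 + Fintype.card (M ⊕ N) * K ^ 2 * Q)) + 1
      with hC₁
    set C₂ : ℝ := (2 * ‖α‖) ^ 3 * ∑ h, 2 * α h with hC₂
    have hC₁0 : 0 < C₁ := by positivity
    have hS0 : 0 ≤ ∑ h, 2 * α h :=
      Finset.sum_nonneg fun h _ => mul_nonneg zero_le_two (hα h).le
    have hC₂0 : 0 ≤ C₂ := mul_nonneg (by positivity) hS0
    refine ⟨C₁ + C₂, by linarith, fun A hA τ hτ hτ1 T hT q qh zs R hN => ?_⟩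
    have hc : ∀ h, 0 ≤ τ * α h := fun h => mul_nonneg hτ.le (hα h).le
    have hcB : ∀ h, τ * α h ≤ ‖α‖ := fun h =>
      (mul_le_of_le_one_left (hα h).le hτ1).trans (hαn h)
    have hT1 : 1 ≤ √(T : ℝ) := Real.one_le_sqrt.2 (by exact_mod_cast hT)
    have hV := hK A hA τ fun h => by rw [abs_of_nonneg (hc h)]; exact hcB h
    have hsum : ∑ t ∈ Finset.Icc 1 T, (TX.prod TY).dilatedBregman α zs (q t) ≤
        (C₁ + C₂) * (T : ℝ) ^ (1 / 4 : ℝ) / τ := by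
      have hr : 0 ≤ (T : ℝ) ^ (1 / 4 : ℝ) := by positivity
      by_cases hlarge : 2 * ‖α‖ ≤ √√(T : ℝ)
      · have hc2 : ∀ h, 2 * (τ * α h) ≤ √√(T : ℝ) := fun h => by linarith [hcB h]
        have h1 := R.sum_dilatedBregman_le_of_move le_rfl hT1 hc hc2 hτ hN hV
          (T := T) (κ' := 1) (one_mul _).ge (Q := Q) (by
            calc _ ≤ ∑ _h : HX ⊕ HY, (2 + (7 * G + 6 * ‖α‖) ^ 2) * √(T : ℝ) :=
                  Finset.sum_le_sum fun h _ => R.sum_move_le_of_tuned hT le_rfl (hc h) (hc2 h)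
                    (hcB h) (R.norm_vec_V_le le_rfl hK0 (fun p hp i => (hV p hp i).1) h)
              _ = Q * √(T : ℝ) := by
                  rw [Finset.sum_const, Finset.card_univ, nsmul_eq_mul, hQ, mul_assoc])
        refine h1.trans (div_le_div_of_nonneg_right ?_ hτ.le)
        exact mul_le_mul_of_nonneg_right (by linarith) hr
      · -- For bounded horizons the bound holds because every divergence is bounded.
        push Not at hlarge
        have h1 : ∑ t ∈ Finset.Icc 1 T, (TX.prod TY).dilatedBregman α zs (q t) ≤
            T * ∑ h, 2 * α h := by
          refine (Finset.sum_le_sum fun t _ => R.dilatedBregman_le le_rfl hα hN t).trans ?_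
          rw [Finset.sum_const, Nat.card_Icc, Nat.add_sub_cancel, nsmul_eq_mul]
        have h2 : (T : ℝ) ≤ (2 * ‖α‖) ^ 3 * √√(T : ℝ) := by
          have h3 : (T : ℝ) = √√(T : ℝ) ^ 3 * √√(T : ℝ) := by
            rw [← pow_succ, show 3 + 1 = 2 * 2 from rfl, pow_mul,
              Real.sq_sqrt (Real.sqrt_nonneg _), Real.sq_sqrt (Nat.cast_nonneg _)]
          nth_rw 1 [h3]
          exact mul_le_mul_of_nonneg_right
            (pow_le_pow_left₀ (Real.sqrt_nonneg _) hlarge.le 3) (Real.sqrt_nonneg _)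
        have h4 : (T : ℝ) * ∑ h, 2 * α h ≤ (C₁ + C₂) * (T : ℝ) ^ (1 / 4 : ℝ) := by
          have h5 := mul_le_mul_of_nonneg_right h2 hS0
          have h6 := mul_nonneg hC₁0.le hr
          rw [rpow_one_fourth_eq] at h6 ⊢
          have h7 : (2 * ‖α‖) ^ 3 * √√(T : ℝ) * ∑ h, 2 * α h = C₂ * √√(T : ℝ) := by
            rw [hC₂]; ring
          linarith
        refine (h1.trans h4).trans ?_
        rw [le_div_iff₀ hτ]
        exact mul_le_of_le_one_right (mul_nonneg (by linarith) hr) hτ1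
    exact ⟨hsum, exists_le_of_sum_le_rpow hT hsum⟩
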